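/- **Notation.** For $x\in\{0,1\}^N$ let $|x|=x_1+\cdots+x_N$, and let $\{0,1\}^N_{\le k}=\{x\in\{0,1\}^N:|x|\le k\}$. For a function $f\colon X\to\mathbb R$ on a finite set $X\subset\mathbb R^N$ and $\epsilon\ge 0$, the $\epsilon$-approximate degree $\deg_\epsilon(f)$ is the least $d$ such that some real polynomial $p$ in $N$ variables of total degree at most $d$ satisfies $|f(x)-p(x)|\le\epsilon$ for all $x\in X$; any polynomial $p$ with $|f(x)-p(x)|\le\epsilon$ on $X$ is called an $\epsilon$-approximant for $f$. Logarithms are to base $2$. **Theorem (Extension theorem).** There are absolute constants $C>1$ and $c\in\mathbb N$ such that the following holds. Let $N\ge m\ge 0$ be integers, let $f\colon\{0,1\}^N_{\le m}\to[-1,1]$, and for integers $n\ge m$ define $F_n\colon\{0,1\}^N_{\le n}\to[-1,1]$ by $F_n(x)=f(x)$ if $|x|\le m$ and $F_n(x)=0$ otherwise. Then for all $\epsilon,\delta\in(0,1/2)$ and all integers $n\ge m$, $$\deg_{\epsilon+\delta}(F_n)\le C\sqrt{\frac{n}{m+1}}\cdot\left(\deg_\epsilon(F_{2m})+\log\frac1\delta\right).$$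 Moreover, there is an explicit transformation of approximants, which uses no information about $f$ or $\epsilon$: for every $\epsilon$-approximant $\phi$ for $F_{2m}$, the polynomial $\Phi$ defined below is an $(\epsilon+\delta)$-approximant for $F_n$, and $$\deg\Phi\le C\sqrt{\frac{n}{m+1}}\cdot\left(\deg\phi+\log\frac1\delta\right).$$ **The transformation.** Let $T_k$ be the Chebyshev polynomial of degree $k$, and let $e=2.718\ldots$ be Euler's number. Let $\psi=\phi$ if $\deg\phi\le 2m$; otherwise let $\psi=\psi_{2m}$, where $\psi_0=\phi(0)$ and $\psi_{k}(x)=\psi_{k-1}(x)+\sum_{|S|=k}(\phi-\psi_{k-1})(\mathbf 1_S)\prod_{i\in S}x_i$, the sum being over the $k$-element sets $S\subseteq\{1,\dots,N\}$ with characteristic vectors $\mathbf 1_S$. Then $\Phi(x)=\psi(x)\,M(x_1+\cdots+x_N)$, where $M$ is the following univariate polynomial. - If $n\le 2m$, then $M=1$. - If $m=0<n$, then $M(t)=T(t)/T(0)$ with $T(t)=T_{\lceil\sqrt n\rceil}\left(1+\frac{1-t}{n}\right)^{\lceil\log(1/\delta)\rceil}$. - If $m\ge1$ and $n>2m$, then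 put $s=n/m$, $d=\max\{\deg\psi,1\}$, $\alpha=\delta/(4e)^{d+1}$, $D=c\lceil d+\log\frac1\alpha\rceil$, $K=c\lceil D+d+\log\frac1\alpha\rceil$, and $M(t)=p(t/m)$ with $p(t)=p_1(t)^d\,p_2(p_1(t))\,p_3(t)$, where $$p_1(t)=\frac{5}{6(t+1)}\left(1-\frac{T_{r}(1-2t/s)}{T_{r}(1+2/s)}\right),\quad r=\lfloor\sqrt{2s}\rfloor+1,\qquad p_2(u)=\sum_{i=0}^{D}\binom{i+d-1}{i}(1-u)^i,$$ $$p_3(t)=\sum_{i=\lceil 2.5e^{-7}K\rceil}^{K}\binom Ki q(t)^i(1-q(t))^{K-i},\qquad q(t)=e^{-7}\left(T_{\lceil\sqrt s\,\rceil}\left(1+\frac{2-t}{s}\right)+1\right).$$ ($p_1$ is a polynomial because the expression in parentheses vanishes at $t=-1$.) -/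

import Mathlib

noncomputable section

namespace ExtensionThm

/-- The points of `{0,1}^N` of Hamming weight `x₁ + ⋯ + x_N` at most `k`, as a subset of `ℝ^N`. -/
def cubeLE (N k : ℕ) : Set (Fin N → ℝ) :=
  {x | (∀ i, x i = 0 ∨ x i = 1) ∧ ∑ i, x i ≤ (k : ℝ)}

/-- `p` approximates `f : X → ℝ` pointwise on `X ⊆ ℝ^N` to within `ε`. -/
def Approximates {N : ℕ} {X : Set (Fin N → ℝ)} (p : MvPolynomial (Fin N) ℝ) (f : X → ℝ)
    (ε : ℝ) : Prop :=
  ∀ x : X, |f x - MvPolynomial.eval (x : Fin N → ℝ) p| ≤ ε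

/-- The `ε`-approximate degree of `f : X → ℝ`: the least `d` such that some real polynomial of total
degree at most `d` approximates `f` on `X` to within `ε`.  (For finite `X` and `ε ≥ 0` such a `d`
always exists, by interpolation.) -/
def approxDeg {N : ℕ} {X : Set (Fin N → ℝ)} (ε : ℝ) (f : X → ℝ) : ℕ :=
  sInf {d : ℕ | ∃ p : MvPolynomial (Fin N) ℝ, p.totalDegree ≤ d ∧ Approximates p f ε}

open Classical in
/-- The function `F_n`: the extension by `0` of `f`, defined on inputs of weight at most `m`, to
inputs of weight at most `n`. -/
def extendZero {N m : ℕ} (f : cubeLE N m → ℝ) (n : ℕ) : cubeLE N n → ℝ :=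
  fun x => if h : (x : Fin N → ℝ) ∈ cubeLE N m then f ⟨x, h⟩ else 0

/-! ### The explicit transformation of approximants -/

/-- The Chebyshev polynomial of degree `k`. -/
def cheb (k : ℕ) : Polynomial ℝ := Polynomial.Chebyshev.T ℝ (k : ℤ)

/-- The polynomial `(1 - T_k(1 - 2(u-1)/s) / T_k(1 + 2/s)) / u` in `u = t + 1`, scaled by `5/6`,
where `k = ⌊√(2s)⌋ + 1`.  (The numerator vanishes at `u = 0`, so `divX` is exact division
by `u`.) -/
def recipPoly (s : ℝ) : Polynomial ℝ :=
  let T : Polynomial ℝ := cheb (⌊√(2 * s)⌋₊ + 1)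
  let q : Polynomial ℝ :=
    Polynomial.C (T.eval (1 + 2 / s))⁻¹ *
      T.comp (Polynomial.C (1 + 2 / s) - Polynomial.C (2 / s) * Polynomial.X)
  Polynomial.C (5 / 6) * (1 - q).divX.comp (Polynomial.X + 1)

/-- The Taylor polynomial `∑_{i ≤ D} binom(i+d-1, i) (1-t)^i` of `t^{-d}` at `t = 1`
(used for `d ≥ 1`). -/
def invPowPoly (d D : ℕ) : Polynomial ℝ :=
  ∑ i ∈ Finset.range (D + 1),
    Polynomial.C ((i + d - 1).choose i : ℝ) * (1 - Polynomial.X) ^ i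

/-- The probability of at least `θ K` heads among `K` independent coin flips, each of which comes up
heads with probability `t`, as a polynomial in `t`. -/
def headsPoly (θ : ℝ) (K : ℕ) : Polynomial ℝ :=
  ∑ i ∈ Finset.Icc ⌈θ * K⌉₊ K,
    Polynomial.C (K.choose i : ℝ) * Polynomial.X ^ i * (1 - Polynomial.X) ^ (K - i)

/-- The polynomial `B(e^{-7} (T_{⌈√s⌉}(1 + (2-t)/s) + 1))`, with `B` the polynomial of the event of
at least `2.5 e^{-7} K` heads among `K` flips. -/
def cutoffPoly (s : ℝ) (K : ℕ) : Polynomial ℝ :=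
  let q : Polynomial ℝ :=
    (cheb ⌈√s⌉₊).comp (Polynomial.C (1 + 2 / s) - Polynomial.C (1 / s) * Polynomial.X)
  (headsPoly (5 / 2 * Real.exp (-7)) K).comp (Polynomial.C (Real.exp (-7)) * (q + 1))

/-- The univariate polynomial `p₁(t)^d p₂(p₁(t)) p₃(t)` that approximates, to within `α`, the
characteristic function of `[0,1]` on `[0,1] ∪ (2,s]`, with decay `α / t^d` on `(2,s]`. -/
def intervalPoly (c : ℕ) (s : ℝ) (d : ℕ) (α : ℝ) : Polynomial ℝ :=
  let D : ℕ := c * ⌈d + Real.logb 2 (1 / α)⌉₊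
  let K : ℕ := c * ⌈D + d + Real.logb 2 (1 / α)⌉₊
  recipPoly s ^ d * (invPowPoly d D).comp (recipPoly s) * cutoffPoly s K

/-- The univariate polynomial in the Hamming weight by which an approximant of degree `e` for
`F_{2m}` is multiplied. -/
def multiplier (c n m : ℕ) (δ : ℝ) (e : ℕ) : Polynomial ℝ :=
  if n ≤ 2 * m then 1
  else if m = 0 then
    let T : Polynomial ℝ :=
      (cheb ⌈√(n : ℝ)⌉₊).comp
        (Polynomial.C (1 + 1 / (n : ℝ)) - Polynomial.C (1 / (n : ℝ)) * Polynomial.X) ^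
          ⌈Real.logb 2 (1 / δ)⌉₊
    Polynomial.C (T.eval 0)⁻¹ * T
  else
    let d : ℕ := max e 1
    (intervalPoly c ((n : ℝ) / m) d (δ / (4 * Real.exp 1) ^ (d + 1))).comp
      (Polynomial.C (1 / (m : ℝ)) * Polynomial.X)

/-- The interpolant of degree at most `k` of the values of `φ` on inputs of weight at most `k`. -/
def interpolant {N : ℕ} (φ : MvPolynomial (Fin N) ℝ) : ℕ → MvPolynomial (Fin N) ℝ
  | 0 => MvPolynomial.C (MvPolynomial.eval 0 φ)
  | k + 1 =>
    interpolant φ k +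
      ∑ S ∈ Finset.powersetCard (k + 1) (Finset.univ : Finset (Fin N)),
        MvPolynomial.C
            (MvPolynomial.eval (fun i => if i ∈ S then (1 : ℝ) else 0) (φ - interpolant φ k)) *
          ∏ i ∈ S, MvPolynomial.X i

/-- The polynomial `φ` itself if its degree is at most `k`, and otherwise the interpolant of its
values on inputs of weight at most `k`. -/
def lowDegree {N : ℕ} (k : ℕ) (φ : MvPolynomial (Fin N) ℝ) : MvPolynomial (Fin N) ℝ :=
  if φ.totalDegree ≤ k then φ else interpolant φ k

/-- The transformation of an approximant `φ` for `F_{2m}` into an approximant for `F_n`: the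
product of `φ` (brought to degree at most `2m`) and a univariate polynomial in `|x|`. -/
def extendApproximant {N : ℕ} (c n m : ℕ) (δ : ℝ) (φ : MvPolynomial (Fin N) ℝ) :
    MvPolynomial (Fin N) ℝ :=
  lowDegree (2 * m) φ *
    Polynomial.aeval (∑ i : Fin N, (MvPolynomial.X i : MvPolynomial (Fin N) ℝ))
      (multiplier c n m δ (lowDegree (2 * m) φ).totalDegree)

end ExtensionThm

end

namespace ExtensionThm

open Finset

/-! ### Chebyshev polynomials on the real line -/

/-! An approximant for `F_{2m}` is uncontrolled above weight 2m, but it cannot grow too fast there.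
Averaging over the subsets of a set of size a ≥ 2m (`exists_symmetrization`) turns its value at that
set into the value at a of a univariate polynomial of degree at most d, bounded by 3/2 at the
integers 0, …, 2m. Lagrange interpolation at equispaced integer nodes bounds this by (3/2)(2e·a/m)^d
(`abs_eval_indVec_le`). The nodes exist because d ≤ 2m; this is why a high-degree approximant is
first replaced by its interpolant on weights up to 2m.

For m ≥ 1 and n > 2m it therefore suffices to multiply by a polynomial M in t = |x|/m that is within
α = δ/(4e)^(d+1) of 1 on [0,1], lies in [0,1] on [0,2], and is at most α/t^d on [2,s], where s =
n/m. Amplifying a cutoff alone to size s^(-d) would cost an extra factor log s in the degree.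
Instead, p₁ equals 1/(t+1) up to a constant factor and has degree O(√s), so p₁^d supplies the decay
(`eval_recipPoly_bounds`). The factor p₂(p₁) undoes p₁^d on [0,2], where p₁ ≥ 2/9
(`one_sub_le_pow_mul_eval_invPowPoly`). On [2,s] it may be as large as 2^(D+d), and the cutoff p₃ is
small enough there to absorb this (`abs_eval_cutoffPoly_le`). The √s in both degrees comes from
Chebyshev growth: T_k is bounded by 1 on [-1,1], yet is at least 1 + k²x at 1 + x.

For m = 0 the approximant is made constant, and a normalized power of a Chebyshev polynomial is
enough. -/

lemma natDegree_cheb (k : ℕ) : (cheb k).natDegree = k := by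
  simp [cheb]

lemma abs_eval_cheb_le_one (k : ℕ) {x : ℝ} (hx : |x| ≤ 1) : |(cheb k).eval x| ≤ 1 :=
  Polynomial.Chebyshev.abs_eval_T_real_le_one _ hx

lemma one_le_eval_cheb (k : ℕ) {x : ℝ} (hx : 1 ≤ x) : 1 ≤ (cheb k).eval x :=
  Polynomial.Chebyshev.one_le_eval_T_real _ hx

lemma eval_cheb_add_two (k : ℕ) (x : ℝ) :
    (cheb (k + 2)).eval x = 2 * x * (cheb (k + 1)).eval x - (cheb k).eval x := by
  have h := Polynomial.Chebyshev.T_add_two ℝ (k : ℤ)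
  simp only [cheb]
  push_cast
  rw [h]
  simp

lemma one_add_sq_mul_le_eval_cheb (k : ℕ) {x : ℝ} (hx : 0 ≤ x) :
    1 + (k : ℝ) ^ 2 * x ≤ (cheb k).eval (1 + x) := by
  -- The first differences are carried along: by the recurrence, the second difference is
  -- 2x·T_{k+1}(1+x) ≥ 2x.
  have key : ∀ k : ℕ, 1 + (k : ℝ) ^ 2 * x ≤ (cheb k).eval (1 + x) ∧
      (cheb k).eval (1 + x) + (2 * k + 1) * x ≤ (cheb (k + 1)).eval (1 + x) := by
    intro k
    induction k with
    | zero => simp [cheb]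
    | succ k ih =>
      have h1 : 1 ≤ (cheb (k + 1)).eval (1 + x) := one_le_eval_cheb _ (by linarith)
      refine ⟨by push_cast; nlinarith [ih.1, ih.2], ?_⟩
      rw [eval_cheb_add_two]
      push_cast
      nlinarith [ih.2]
  exact (key k).1

lemma one_add_sq_div_two_le_cosh {y : ℝ} (hy : 0 ≤ y) : 1 + y ^ 2 / 2 ≤ Real.cosh y := by
  have h1 : Real.cosh y = 1 + 2 * Real.sinh (y / 2) ^ 2 := by
    have := Real.cosh_two_mul (y / 2)
    rw [mul_div_cancel₀ y (two_ne_zero)] at this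
    rw [this, Real.cosh_sq]; ring
  have h2 : y / 2 ≤ Real.sinh (y / 2) := Real.self_le_sinh_iff.2 (by linarith)
  rw [h1]
  nlinarith

/-- With 1 + x = cosh y one has T_k(1+x) = cosh(ky) ≤ e^(ky), and cosh y ≥ 1 + y²/2 gives y ≤ √(2x).
-/
lemma eval_cheb_le_exp (k : ℕ) {x : ℝ} (hx : 0 ≤ x) :
    (cheb k).eval (1 + x) ≤ Real.exp (k * √(2 * x)) := by
  have h1 : (1 : ℝ) ≤ 1 + x := by linarith
  have hy := Real.arcosh_nonneg h1
  have hc := Real.cosh_arcosh h1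
  have h2 := one_add_sq_div_two_le_cosh hy
  set y := Real.arcosh (1 + x)
  have hyx : y ≤ √(2 * x) := Real.le_sqrt_of_sq_le (by linarith)
  rw [← hc, cheb, Polynomial.Chebyshev.T_real_cosh]
  push_cast
  have hky : 0 ≤ (k : ℝ) * y := by positivity
  calc Real.cosh (k * y) ≤ Real.exp (k * y) := by
        rw [Real.cosh_eq]
        have : Real.exp (-(k * y)) ≤ Real.exp (k * y) := Real.exp_le_exp.2 (by linarith)
        linarith
    _ ≤ _ := Real.exp_le_exp.2 (by gcongr)

/-! ### The approximate reciprocal -/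

lemma add_one_mul_eval_recipPoly (s t : ℝ) (hs : 0 < s) :
    (t + 1) * (recipPoly s).eval t = 5 / 6 * (1 -
      (cheb (⌊√(2 * s)⌋₊ + 1)).eval (1 - 2 * t / s) /
        (cheb (⌊√(2 * s)⌋₊ + 1)).eval (1 + 2 / s)) := by
  set T := cheb (⌊√(2 * s)⌋₊ + 1) with hT
  have hpos : T.eval (1 + 2 / s) ≠ 0 := by
    have := one_le_eval_cheb (⌊√(2 * s)⌋₊ + 1) (x := 1 + 2 / s) (by linarith [div_pos two_pos hs])
    rw [← hT] at this
    linarith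
  set q : Polynomial ℝ := Polynomial.C (T.eval (1 + 2 / s))⁻¹ *
      T.comp (Polynomial.C (1 + 2 / s) - Polynomial.C (2 / s) * Polynomial.X) with hq
  have h0 : (1 - q).coeff 0 = 0 := by
    rw [Polynomial.coeff_zero_eq_eval_zero]
    simp [hq, Polynomial.eval_comp, inv_mul_cancel₀ hpos]
  have h1 := Polynomial.divX_mul_X_add (1 - q)
  rw [h0, map_zero, add_zero] at h1
  have h2 : (1 - q).eval (t + 1) = (1 - q).divX.eval (t + 1) * (t + 1) := by
    conv_lhs => rw [← h1]
    simp
  have h3 : (1 - q).eval (t + 1) = 1 - T.eval (1 - 2 * t / s) / T.eval (1 + 2 / s) := by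
    have : 1 + 2 / s - 2 / s * (t + 1) = 1 - 2 * t / s := by ring
    rw [div_eq_inv_mul, hq, ← this]
    simp only [Polynomial.eval_sub, Polynomial.eval_one, Polynomial.eval_mul, Polynomial.eval_C,
      Polynomial.eval_comp, Polynomial.eval_X]
  have h4 : (recipPoly s).eval t = 5 / 6 * (1 - q).divX.eval (t + 1) := by
    simp [recipPoly, hq, hT, Polynomial.eval_comp]
  rw [h4, ← h3, h2]
  ring

/-- On [0,s] the numerator T_k(1-2t/s) is at most 1 in absolute value, while T_k(1+2/s) ≥ 1 + 2k²/s
≥ 5. The ratio is thus at most 1/5, and the factor 5/6 maps [4/5, 6/5] to [2/3, 1]. -/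
lemma eval_recipPoly_bounds {s t : ℝ} (hs : 0 < s) (ht0 : 0 ≤ t) (hts : t ≤ s) :
    2 / 3 ≤ (t + 1) * (recipPoly s).eval t ∧ (t + 1) * (recipPoly s).eval t ≤ 1 := by
  rw [add_one_mul_eval_recipPoly s t hs]
  set k := ⌊√(2 * s)⌋₊ + 1 with hk
  have h1 : |(cheb k).eval (1 - 2 * t / s)| ≤ 1 := by
    apply abs_eval_cheb_le_one
    have a : 0 ≤ t / s := by positivity
    have b : t / s ≤ 1 := (div_le_one hs).2 hts
    rw [mul_div_assoc, abs_le]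
    constructor <;> linarith
  have h2 : 5 ≤ (cheb k).eval (1 + 2 / s) := by
    have h := one_add_sq_mul_le_eval_cheb k (x := 2 / s) (by positivity)
    have hk2 : 2 * s ≤ (k : ℝ) ^ 2 := by
      have : √(2 * s) ≤ k := by
        rw [hk]; push_cast; exact (Nat.lt_floor_add_one _).le
      exact (Real.sqrt_le_left (by positivity)).1 this
    have : 2 * s * (2 / s) ≤ (k : ℝ) ^ 2 * (2 / s) := by gcongr
    have h4 : 2 * s * (2 / s) = 4 := by field_simp; norm_num
    linarith
  have h3 : |(cheb k).eval (1 - 2 * t / s) / (cheb k).eval (1 + 2 / s)| ≤ 1 / 5 := by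
    rw [abs_div, abs_of_pos (by linarith : 0 < (cheb k).eval (1 + 2 / s)),
      div_le_iff₀ (by linarith)]
    linarith
  rw [abs_le] at h3
  constructor <;> linarith [h3.1, h3.2]

lemma natDegree_recipPoly_le (s : ℝ) : (recipPoly s).natDegree ≤ ⌊√(2 * s)⌋₊ := by
  simp only [recipPoly]
  refine (Polynomial.natDegree_C_mul_le _ _).trans ?_
  refine Polynomial.natDegree_comp_le.trans ?_
  have h1 : (Polynomial.X + 1 : Polynomial ℝ).natDegree = 1 :=
    Polynomial.natDegree_X_add_C (1 : ℝ)
  rw [h1, mul_one, Polynomial.natDegree_divX_eq_natDegree_tsub_one, Nat.sub_le_iff_le_add]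
  refine (Polynomial.natDegree_sub_le _ _).trans ?_
  rw [Polynomial.natDegree_one, Nat.zero_max]
  refine (Polynomial.natDegree_C_mul_le _ _).trans (Polynomial.natDegree_comp_le.trans ?_)
  rw [natDegree_cheb]
  have h2 : (Polynomial.C (1 + 2 / s) - Polynomial.C (2 / s) * Polynomial.X :
      Polynomial ℝ).natDegree ≤ 1 := by
    compute_degree
  exact (Nat.mul_le_mul_left _ h2).trans (mul_one _).le

/-! ### The truncated binomial series -/

lemma eval_invPowPoly (d D : ℕ) (hd : 1 ≤ d) (u : ℝ) : (invPowPoly d D).eval u =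
    ∑ i ∈ range (D + 1), ((i + (d - 1)).choose (d - 1) : ℝ) * (1 - u) ^ i := by
  simp only [invPowPoly, Polynomial.eval_finsetSum]
  refine sum_congr rfl fun i _ => ?_
  have : (i + d - 1).choose i = (i + (d - 1)).choose (d - 1) := by
    rw [Nat.add_sub_assoc hd, Nat.choose_symm_add]
  simp [this]

lemma hasSum_inv_pow {d : ℕ} (hd : 1 ≤ d) {v : ℝ} (h0 : 0 ≤ v) (h1 : v < 1) :
    HasSum (fun i : ℕ => ((i + (d - 1)).choose (d - 1) : ℝ) * v ^ i) (1 / (1 - v) ^ d) := by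
  have h := hasSum_choose_mul_geometric_of_norm_lt_one (d - 1) (r := v)
    (by rwa [Real.norm_of_nonneg h0])
  rwa [Nat.sub_add_cancel hd] at h

lemma eval_invPowPoly_nonneg {d D : ℕ} (hd : 1 ≤ d) {u : ℝ} (h1 : u ≤ 1) :
    0 ≤ (invPowPoly d D).eval u := by
  rw [eval_invPowPoly d D hd]
  have : 0 ≤ 1 - u := by linarith
  positivity

/-- A partial sum of a series with nonnegative terms and total u^(-d). -/
lemma pow_mul_eval_invPowPoly_le_one {d D : ℕ} (hd : 1 ≤ d) {u : ℝ} (h0 : 0 < u) (h1 : u ≤ 1) :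
    u ^ d * (invPowPoly d D).eval u ≤ 1 := by
  have h := hasSum_inv_pow hd (v := 1 - u) (by linarith) (by linarith)
  have hle := sum_le_hasSum (range (D + 1))
    (fun i _ => by have : 0 ≤ 1 - u := by linarith
                   positivity) h
  rw [← eval_invPowPoly d D hd, sub_sub_cancel, le_div_iff₀ (by positivity)] at hle
  linarith

/-- Since 1 - u ≤ 7/9 = (7/8)(8/9), the tail beyond D is at most (7/8)^D times the whole series at
8/9, which sums to 9^d. -/
lemma one_sub_le_pow_mul_eval_invPowPoly {d D : ℕ} (hd : 1 ≤ d) {u : ℝ} (h0 : 2 / 9 ≤ u)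
    (h1 : u ≤ 1) :
    1 - (7 / 8) ^ D * 9 ^ d ≤ u ^ d * (invPowPoly d D).eval u := by
  have hu : 0 < u := by linarith
  have h := hasSum_inv_pow hd (v := 1 - u) (by linarith) (by linarith)
  have hw := hasSum_inv_pow hd (v := 8 / 9) (by norm_num) (by norm_num)
  have hw2 : (1 : ℝ) / (1 - 8 / 9) ^ d = 9 ^ d := by
    rw [show (1 : ℝ) - 8 / 9 = 9⁻¹ by norm_num, inv_pow, one_div, inv_inv]
  rw [hw2] at hw
  have hsplit := h.summable.sum_add_tsum_nat_add (D + 1)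
  rw [h.tsum_eq, ← eval_invPowPoly d D hd, sub_sub_cancel] at hsplit
  set f : ℕ → ℝ := fun i => ((i + (d - 1)).choose (d - 1) : ℝ) * (1 - u) ^ i with hf
  set g : ℕ → ℝ := fun i => ((i + (d - 1)).choose (d - 1) : ℝ) * (8 / 9) ^ i with hg
  have hcmp : ∀ i, f (i + (D + 1)) ≤ (7 / 8) ^ D * g (i + (D + 1)) := by
    intro i
    simp only [hf, hg]
    have e1 : (1 - u) ^ (i + (D + 1)) ≤ (7 / 9) ^ (i + (D + 1)) :=
      pow_le_pow_left₀ (by linarith) (by linarith) _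
    have e2 : ((7 : ℝ) / 9) ^ (i + (D + 1)) ≤ (7 / 8) ^ D * (8 / 9) ^ (i + (D + 1)) := by
      rw [show (7 : ℝ) / 9 = 7 / 8 * (8 / 9) by norm_num, mul_pow]
      gcongr ?_ * _
      exact pow_le_pow_of_le_one (by norm_num) (by norm_num) (by omega)
    calc _ ≤ ((i + (D + 1) + (d - 1)).choose (d - 1) : ℝ) *
          ((7 / 8) ^ D * (8 / 9) ^ (i + (D + 1))) := by gcongr; exact e1.trans e2
      _ = _ := by ring
  have hgs : Summable fun i => g (i + (D + 1)) := (summable_nat_add_iff (D + 1)).2 hw.summable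
  have hfs : Summable fun i => f (i + (D + 1)) := (summable_nat_add_iff (D + 1)).2 h.summable
  have htail : ∑' i, f (i + (D + 1)) ≤ (7 / 8) ^ D * 9 ^ d := by
    calc _ ≤ ∑' i, (7 / 8) ^ D * g (i + (D + 1)) :=
          hfs.tsum_le_tsum hcmp (hgs.mul_left _)
      _ = (7 / 8) ^ D * ∑' i, g (i + (D + 1)) := tsum_mul_left
      _ ≤ _ := by
          gcongr
          have := hw.summable.sum_add_tsum_nat_add (D + 1)
          rw [hw.tsum_eq] at this
          have hn : 0 ≤ ∑ i ∈ range (D + 1), g i := sum_nonneg fun i _ => by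
            simp only [hg]; positivity
          linarith
  have hud : u ^ d ≤ 1 := pow_le_one₀ hu.le h1
  have hud0 : 0 < u ^ d := by positivity
  have hkey : u ^ d * (invPowPoly d D).eval u = 1 - u ^ d * ∑' i, f (i + (D + 1)) := by
    have : (invPowPoly d D).eval u = 1 / u ^ d - ∑' i, f (i + (D + 1)) := by linarith
    rw [this, mul_sub, mul_one_div_cancel hud0.ne']
  have hnn : 0 ≤ ∑' i, f (i + (D + 1)) := tsum_nonneg fun i => by
    have : 0 ≤ 1 - u := by linarith
    simp only [hf]; positivity
  rw [hkey]
  nlinarith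

/-- A crude bound that survives as u tends to 0, by the hockey-stick identity; the cutoff polynomial
compensates for it. -/
lemma eval_invPowPoly_le {d D : ℕ} (hd : 1 ≤ d) {u : ℝ} (h0 : 0 ≤ u) (h1 : u ≤ 1) :
    (invPowPoly d D).eval u ≤ 2 ^ (D + d) := by
  rw [eval_invPowPoly d D hd]
  calc _ ≤ ∑ i ∈ range (D + 1), ((i + (d - 1)).choose (d - 1) : ℝ) := by
        refine sum_le_sum fun i _ => ?_
        exact mul_le_of_le_one_right (by positivity) (pow_le_one₀ (by linarith) (by linarith))
    _ = ((D + (d - 1) + 1).choose (d - 1 + 1) : ℕ) := by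
        rw [← Nat.sum_range_add_choose]; push_cast; rfl
    _ ≤ _ := by
        rw [Nat.sub_add_cancel hd, show D + (d - 1) + 1 = D + d by omega]
        exact_mod_cast Nat.choose_le_two_pow _ _

lemma natDegree_invPowPoly_le (d D : ℕ) : (invPowPoly d D).natDegree ≤ D := by
  unfold invPowPoly
  refine Polynomial.natDegree_sum_le_of_forall_le _ _ fun i hi => ?_
  have hi' : i ≤ D := by simpa [Nat.lt_succ_iff] using hi
  refine (Polynomial.natDegree_C_mul_le _ _).trans (Polynomial.natDegree_pow_le.trans ?_)
  have : (1 - Polynomial.X : Polynomial ℝ).natDegree ≤ 1 := by compute_degree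
  nlinarith

/-! ### Tails of the binomial distribution -/

lemma eval_headsPoly (θ : ℝ) (K : ℕ) (q : ℝ) : (headsPoly θ K).eval q =
    ∑ i ∈ Icc ⌈θ * K⌉₊ K, (K.choose i : ℝ) * q ^ i * (1 - q) ^ (K - i) := by
  simp [headsPoly, Polynomial.eval_finsetSum]

lemma sum_binomial_eq (K : ℕ) (q z : ℝ) :
    ∑ i ∈ range (K + 1), (K.choose i : ℝ) * q ^ i * (1 - q) ^ (K - i) * z ^ i =
      (1 - q + q * z) ^ K := by
  rw [add_comm (1 - q), add_pow]
  refine sum_congr rfl fun i _ => ?_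
  rw [mul_pow]; ring

/-- The Chernoff bound, for both tails at once: l > 0 serves the upper tail and l < 0 the lower.
Each term of the tail is weighted by exp(l(i - θK)) ≥ 1, and the sum is then extended to all i. -/
lemma sum_binomial_filter_le {K : ℕ} {q θ l : ℝ} (hq0 : 0 ≤ q) (hq1 : q ≤ 1) (S : Finset ℕ)
    (hS : S ⊆ range (K + 1)) (hl : ∀ i ∈ S, 0 ≤ l * (i - θ * K)) :
    ∑ i ∈ S, (K.choose i : ℝ) * q ^ i * (1 - q) ^ (K - i) ≤
      Real.exp (q * (Real.exp l - 1) - l * θ) ^ K := by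
  have hq2 : 0 ≤ 1 - q := by linarith
  calc _ ≤ ∑ i ∈ S, (K.choose i : ℝ) * q ^ i * (1 - q) ^ (K - i) *
        Real.exp (l * (i - θ * K)) := by
        refine sum_le_sum fun i hi => le_mul_of_one_le_right (by positivity) ?_
        exact Real.one_le_exp (hl i hi)
    _ ≤ ∑ i ∈ range (K + 1), (K.choose i : ℝ) * q ^ i * (1 - q) ^ (K - i) *
        Real.exp (l * (i - θ * K)) :=
        sum_le_sum_of_subset_of_nonneg hS fun i _ _ => by positivity
    _ = Real.exp (-(l * θ)) ^ K *
        ∑ i ∈ range (K + 1), (K.choose i : ℝ) * q ^ i * (1 - q) ^ (K - i) * Real.exp l ^ i := by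
        rw [mul_sum]
        refine sum_congr rfl fun i _ => ?_
        rw [← Real.exp_nat_mul, ← Real.exp_nat_mul,
          show l * (i - θ * K) = K * (-(l * θ)) + i * l by ring, Real.exp_add]
        ring
    _ = (Real.exp (-(l * θ)) * (1 - q + q * Real.exp l)) ^ K := by
        rw [sum_binomial_eq, mul_pow]
    _ ≤ _ := by
        have h1 : 0 ≤ 1 - q + q * Real.exp l := by positivity
        have h2 : 1 - q + q * Real.exp l ≤ Real.exp (q * (Real.exp l - 1)) := by
          have := Real.add_one_le_exp (q * (Real.exp l - 1))
          linarith
        refine pow_le_pow_left₀ (by positivity) ?_ _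
        rw [show q * (Real.exp l - 1) - l * θ = -(l * θ) + q * (Real.exp l - 1) by ring,
          Real.exp_add]
        gcongr

lemma eval_headsPoly_nonneg {θ q : ℝ} {K : ℕ} (hq0 : 0 ≤ q) (hq1 : q ≤ 1) :
    0 ≤ (headsPoly θ K).eval q := by
  have hq2 : 0 ≤ 1 - q := by linarith
  rw [eval_headsPoly]
  positivity

lemma eval_headsPoly_add_eq_one {θ q : ℝ} {K : ℕ} (hθ : θ ≤ 1) :
    (headsPoly θ K).eval q +
      ∑ i ∈ range ⌈θ * K⌉₊, (K.choose i : ℝ) * q ^ i * (1 - q) ^ (K - i) = 1 := by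
  have h := sum_binomial_eq K q 1
  simp only [one_pow, mul_one, sub_add_cancel] at h
  have hle : ⌈θ * K⌉₊ ≤ K + 1 := by
    refine (Nat.ceil_le.2 ?_).trans (Nat.le_succ K)
    exact mul_le_of_le_one_left (by positivity) hθ
  rw [eval_headsPoly, add_comm]
  exact (Finset.sum_range_add_sum_Ico _ hle).trans h

lemma eval_headsPoly_le_one {θ q : ℝ} {K : ℕ} (hθ : θ ≤ 1) (hq0 : 0 ≤ q) (hq1 : q ≤ 1) :
    (headsPoly θ K).eval q ≤ 1 := by
  have h := eval_headsPoly_add_eq_one (q := q) (K := K) hθ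
  have hq2 : 0 ≤ 1 - q := by linarith
  have : 0 ≤ ∑ i ∈ range ⌈θ * K⌉₊, (K.choose i : ℝ) * q ^ i * (1 - q) ^ (K - i) := by
    positivity
  linarith

lemma exp_tenth_le : Real.exp (1 / 10) - 1 ≤ 1 / 9 := by
  have h := Real.add_one_le_exp (-(1 / 10) : ℝ)
  rw [Real.exp_neg] at h
  have hp := Real.exp_pos (1 / 10)
  have : Real.exp (1 / 10) * (9 / 10) ≤ 1 := by
    calc _ ≤ Real.exp (1 / 10) * (Real.exp (1 / 10))⁻¹ := by gcongr; linarith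
      _ = 1 := mul_inv_cancel₀ hp.ne'
  linarith

lemma exp_neg_tenth_le : Real.exp (-(1 / 10)) - 1 ≤ -(1 / 11) := by
  have h := Real.add_one_le_exp (1 / 10 : ℝ)
  have hp := Real.exp_pos (-(1 / 10))
  have : Real.exp (-(1 / 10)) * (11 / 10) ≤ 1 := by
    calc _ ≤ Real.exp (-(1 / 10)) * Real.exp (1 / 10) := by gcongr; linarith
      _ = 1 := by rw [← Real.exp_add]; simp
  linarith

lemma eval_headsPoly_le_of_le {η q : ℝ} {K : ℕ} (hq0 : 0 ≤ q) (hq1 : q ≤ 1)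
    (hq : q ≤ 2 * η) :
    (headsPoly (5 / 2 * η) K).eval q ≤ Real.exp (-(η / 50)) ^ K := by
  rw [eval_headsPoly]
  refine (sum_binomial_filter_le (θ := 5 / 2 * η) (l := 1 / 10) hq0 hq1 _ ?_ ?_).trans ?_
  · intro i hi
    simp only [mem_Icc, mem_range] at *
    omega
  · intro i hi
    have := Nat.ceil_le.1 (mem_Icc.1 hi).1
    exact mul_nonneg (by norm_num) (by linarith)
  · gcongr
    -- The exponent is at most 2η/9 - η/4 = -η/36.
    nlinarith [exp_tenth_le]

lemma one_sub_le_eval_headsPoly {η q : ℝ} {K : ℕ} (hη : 5 / 2 * η ≤ 1)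
    (hη0 : 0 ≤ η) (hq1 : q ≤ 1) (hq : 3 * η ≤ q) :
    1 - Real.exp (-(η / 50)) ^ K ≤ (headsPoly (5 / 2 * η) K).eval q := by
  have h := eval_headsPoly_add_eq_one (q := q) (K := K) hη
  have hle : ⌈5 / 2 * η * K⌉₊ ≤ K + 1 := by
    refine (Nat.ceil_le.2 ?_).trans (Nat.le_succ K)
    exact mul_le_of_le_one_left (by positivity) hη
  have h2 := sum_binomial_filter_le (θ := 5 / 2 * η) (l := -(1 / 10)) (K := K)
    (by linarith : 0 ≤ q) hq1 (range ⌈5 / 2 * η * K⌉₊) (range_mono hle) (fun i hi => by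
      have := (Nat.lt_ceil.1 (mem_range.1 hi)).le
      exact mul_nonneg_of_nonpos_of_nonpos (by norm_num) (by linarith))
  have h3 : Real.exp (q * (Real.exp (-(1 / 10)) - 1) - -(1 / 10) * (5 / 2 * η)) ^ K ≤
      Real.exp (-(η / 50)) ^ K := by
    gcongr
    -- The exponent is at most -3η/11 + η/4 = -η/44.
    nlinarith [exp_neg_tenth_le]
  linarith

lemma natDegree_headsPoly_le (θ : ℝ) (K : ℕ) : (headsPoly θ K).natDegree ≤ K := by
  unfold headsPoly
  refine Polynomial.natDegree_sum_le_of_forall_le _ _ fun i hi => ?_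
  have hi' : i ≤ K := (mem_Icc.1 hi).2
  have h1 : (1 - Polynomial.X : Polynomial ℝ).natDegree ≤ 1 := by compute_degree
  refine Polynomial.natDegree_mul_le.trans ?_
  have h2 := Polynomial.natDegree_C_mul_le (K.choose i : ℝ) (Polynomial.X ^ i)
  rw [Polynomial.natDegree_X_pow] at h2
  have h3 : ((1 - Polynomial.X : Polynomial ℝ) ^ (K - i)).natDegree ≤ (K - i) * 1 :=
    Polynomial.natDegree_pow_le.trans (by gcongr)
  omega

/-! ### The cutoff polynomial -/

lemma exp_neg_seven_lt : Real.exp (-7) < 1 / 8 := by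
  rw [Real.exp_neg, ← one_div]
  have := Real.add_one_lt_exp (show (7 : ℝ) ≠ 0 by norm_num)
  exact one_div_lt_one_div_of_lt (by norm_num) (by linarith)

lemma eval_cutoffPoly (s : ℝ) (K : ℕ) (t : ℝ) : (cutoffPoly s K).eval t =
    (headsPoly (5 / 2 * Real.exp (-7)) K).eval
      (Real.exp (-7) * ((cheb ⌈√s⌉₊).eval (1 + (2 - t) / s) + 1)) := by
  have : 1 + 2 / s - 1 / s * t = 1 + (2 - t) / s := by ring
  simp only [cutoffPoly, Polynomial.eval_comp, Polynomial.eval_mul, Polynomial.eval_add,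
    Polynomial.eval_sub, Polynomial.eval_C, Polynomial.eval_X, Polynomial.eval_one, this]

/-- This explains the factor e^(-7): on [0,2] the Chebyshev value is at most exp(2√s · 2/√s) = e⁴,
and e⁴ + 1 ≤ e⁷, so the argument is a legitimate probability of heads. -/
lemma cutoff_arg_le_one {s t : ℝ} (hs : 2 ≤ s) (ht0 : 0 ≤ t) (ht2 : t ≤ 2) :
    Real.exp (-7) * ((cheb ⌈√s⌉₊).eval (1 + (2 - t) / s) + 1) ≤ 1 := by
  have hx0 : 0 ≤ (2 - t) / s := div_nonneg (by linarith) (by linarith)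
  have hs1 : 1 ≤ √s := Real.one_le_sqrt.2 (by linarith)
  have h1 := eval_cheb_le_exp ⌈√s⌉₊ hx0
  have h2 : √(2 * ((2 - t) / s)) ≤ 2 / √s := by
    rw [Real.sqrt_le_left (by positivity), div_pow, Real.sq_sqrt (by linarith),
      ← mul_div_assoc]
    gcongr
    linarith
  have h3 : (⌈√s⌉₊ : ℝ) ≤ 2 * √s := by
    have := Nat.ceil_lt_add_one (Real.sqrt_nonneg s)
    linarith
  have h4 : (⌈√s⌉₊ : ℝ) * √(2 * ((2 - t) / s)) ≤ 4 := by
    calc _ ≤ 2 * √s * (2 / √s) := by gcongr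
      _ = 4 := by field_simp; norm_num
  have h5 : (cheb ⌈√s⌉₊).eval (1 + (2 - t) / s) ≤ Real.exp 4 :=
    h1.trans (Real.exp_le_exp.2 h4)
  have h6 : Real.exp 4 + 1 ≤ Real.exp 7 := by
    rw [show (7 : ℝ) = 4 + 3 by norm_num, Real.exp_add]
    have a := Real.add_one_le_exp (3 : ℝ)
    have b := Real.one_le_exp (show (0 : ℝ) ≤ 4 by norm_num)
    nlinarith
  calc _ ≤ Real.exp (-7) * Real.exp 7 := by gcongr; linarith
    _ = 1 := by rw [← Real.exp_add]; simp

lemma eval_cutoffPoly_mem_Icc {s t : ℝ} {K : ℕ} (hs : 2 ≤ s) (ht0 : 0 ≤ t) (ht2 : t ≤ 2) :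
    0 ≤ (cutoffPoly s K).eval t ∧ (cutoffPoly s K).eval t ≤ 1 := by
  have h1 := one_le_eval_cheb ⌈√s⌉₊ (x := 1 + (2 - t) / s)
    (by linarith [div_nonneg (by linarith : 0 ≤ 2 - t) (by linarith : 0 ≤ s)])
  have h0 : 0 ≤ Real.exp (-7) * ((cheb ⌈√s⌉₊).eval (1 + (2 - t) / s) + 1) := by
    have := Real.exp_pos (-7)
    have : 0 ≤ (cheb ⌈√s⌉₊).eval (1 + (2 - t) / s) + 1 := by linarith
    positivity
  rw [eval_cutoffPoly]
  exact ⟨eval_headsPoly_nonneg h0 (cutoff_arg_le_one hs ht0 ht2),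
    eval_headsPoly_le_one (by linarith [exp_neg_seven_lt]) h0 (cutoff_arg_le_one hs ht0 ht2)⟩

/-- For t ≤ 1 the Chebyshev value is at least 1 + s · (1/s) = 2, so the probability of heads is at
least 3e^(-7), above the threshold 2.5e^(-7). -/
lemma one_sub_le_eval_cutoffPoly {s t : ℝ} {K : ℕ} (hs : 2 ≤ s) (ht0 : 0 ≤ t) (ht1 : t ≤ 1) :
    1 - Real.exp (-(Real.exp (-7) / 50)) ^ K ≤ (cutoffPoly s K).eval t := by
  rw [eval_cutoffPoly]
  refine one_sub_le_eval_headsPoly (by linarith [exp_neg_seven_lt]) (Real.exp_pos _).le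
    (cutoff_arg_le_one hs ht0 (by linarith)) ?_
  have h1 := one_add_sq_mul_le_eval_cheb ⌈√s⌉₊ (x := (2 - t) / s)
    (div_nonneg (by linarith) (by linarith))
  have h2 : 1 ≤ (⌈√s⌉₊ : ℝ) ^ 2 * ((2 - t) / s) := by
    have : s ≤ (⌈√s⌉₊ : ℝ) ^ 2 := (Real.sqrt_le_left (by positivity)).1 (Nat.le_ceil _)
    rw [← mul_div_assoc, le_div_iff₀ (by linarith)]
    nlinarith
  have := Real.exp_pos (-7)
  nlinarith

/-- Here the Chebyshev argument lies in [-1,1], so the probability of heads is at most 2e^(-7),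
below the threshold. -/
lemma abs_eval_cutoffPoly_le {s t : ℝ} {K : ℕ} (hs : 2 ≤ s) (ht2 : 2 ≤ t) (hts : t ≤ s) :
    0 ≤ (cutoffPoly s K).eval t ∧
      (cutoffPoly s K).eval t ≤ Real.exp (-(Real.exp (-7) / 50)) ^ K := by
  have h1 : |(cheb ⌈√s⌉₊).eval (1 + (2 - t) / s)| ≤ 1 := by
    apply abs_eval_cheb_le_one
    have a : 0 ≤ (t - 2) / s := div_nonneg (by linarith) (by linarith)
    have b : (t - 2) / s ≤ 1 := (div_le_one (by linarith)).2 (by linarith)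
    have e : (2 - t) / s = -((t - 2) / s) := by ring
    rw [e, abs_le]
    constructor <;> linarith
  rw [abs_le] at h1
  have hp := Real.exp_pos (-7)
  have h0 : 0 ≤ Real.exp (-7) * ((cheb ⌈√s⌉₊).eval (1 + (2 - t) / s) + 1) :=
    mul_nonneg hp.le (by linarith)
  have h2 : Real.exp (-7) * ((cheb ⌈√s⌉₊).eval (1 + (2 - t) / s) + 1) ≤ 2 * Real.exp (-7) := by
    nlinarith
  have h3 := exp_neg_seven_lt
  rw [eval_cutoffPoly]
  exact ⟨eval_headsPoly_nonneg h0 (by linarith), eval_headsPoly_le_of_le h0 (by linarith) h2⟩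

lemma natDegree_cutoffPoly_le (s : ℝ) (K : ℕ) : (cutoffPoly s K).natDegree ≤ K * ⌈√s⌉₊ := by
  simp only [cutoffPoly]
  refine Polynomial.natDegree_comp_le.trans (Nat.mul_le_mul (natDegree_headsPoly_le _ _) ?_)
  refine (Polynomial.natDegree_C_mul_le _ _).trans ((Polynomial.natDegree_add_le _ _).trans ?_)
  rw [Polynomial.natDegree_one, Nat.max_zero]
  refine Polynomial.natDegree_comp_le.trans ?_
  rw [natDegree_cheb]
  have h2 : (Polynomial.C (1 + 2 / s) - Polynomial.C (1 / s) * Polynomial.X :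
      Polynomial ℝ).natDegree ≤ 1 := by
    compute_degree
  exact (Nat.mul_le_mul_left _ h2).trans (mul_one _).le

end ExtensionThm

namespace ExtensionThm

open Finset

/-! ### The univariate approximant of an interval -/

lemma half_pow_ceil_logb_le {α : ℝ} (hα : 0 < α) : (1 / 2 : ℝ) ^ ⌈Real.logb 2 (1 / α)⌉₊ ≤ α := by
  have h := Nat.le_ceil (Real.logb 2 (1 / α))
  rw [Real.logb_le_iff_le_rpow (by norm_num) (by positivity), Real.rpow_natCast] at h
  rw [one_div 2, inv_pow]
  exact inv_le_of_inv_le₀ hα ((one_div α).symm.le.trans h)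

lemma intervalPoly_eq (c : ℕ) (s : ℝ) (d : ℕ) {α : ℝ} (hα0 : 0 < α) (hα1 : α ≤ 1) :
    intervalPoly c s d α =
      recipPoly s ^ d * (invPowPoly d (c * (d + ⌈Real.logb 2 (1 / α)⌉₊))).comp (recipPoly s) *
        cutoffPoly s (c * (c * (d + ⌈Real.logb 2 (1 / α)⌉₊) + d + ⌈Real.logb 2 (1 / α)⌉₊)) := by
  have hL : 0 ≤ Real.logb 2 (1 / α) := by
    apply Real.logb_nonneg (by norm_num)
    rw [le_div_iff₀ hα0]; linarith
  have h : ∀ k : ℕ, ⌈(k : ℝ) + Real.logb 2 (1 / α)⌉₊ = k + ⌈Real.logb 2 (1 / α)⌉₊ := by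
    intro k
    rw [add_comm, Nat.ceil_add_natCast hL, add_comm]
  simp only [intervalPoly]
  rw [h d, ← Nat.cast_add, h]

/-- The requirements on the constant `c` of the construction. -/
structure Admissible (c : ℕ) : Prop where
  one_le : 1 ≤ c
  tail_le : Real.exp (-(Real.exp (-7) / 50)) ^ c ≤ 1 / 2
  series_le : (7 / 8 : ℝ) ^ c ≤ 1 / 18

lemma exists_admissible : ∃ c, Admissible c := by
  have h0 : Real.exp (-(Real.exp (-7) / 50)) < 1 := by
    rw [Real.exp_lt_one_iff]
    linarith [Real.exp_pos (-7)]
  obtain ⟨a, ha⟩ := exists_pow_lt_of_lt_one (show (0 : ℝ) < 1 / 2 by norm_num) h0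
  obtain ⟨b, hb⟩ := exists_pow_lt_of_lt_one (show (0 : ℝ) < 1 / 18 by norm_num)
    (show (7 / 8 : ℝ) < 1 by norm_num)
  refine ⟨max (max a b) 1, le_max_right _ _, ?_, ?_⟩
  · exact (pow_le_pow_of_le_one (Real.exp_pos _).le h0.le
      ((le_max_left a b).trans (le_max_left _ _))).trans ha.le
  · exact (pow_le_pow_of_le_one (by norm_num) (by norm_num)
      ((le_max_right a b).trans (le_max_left _ _))).trans hb.le

section interval

variable {c d : ℕ} {s t α : ℝ}

lemma eval_recipPoly_mem (hs : 2 ≤ s) (ht0 : 0 ≤ t) (hts : t ≤ s) :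
    0 < (recipPoly s).eval t ∧ (recipPoly s).eval t ≤ 1 := by
  obtain ⟨h1, h2⟩ := eval_recipPoly_bounds (by linarith) ht0 hts
  have h3 : 0 < (recipPoly s).eval t := pos_of_mul_pos_right (by linarith) (by linarith : 0 ≤ t + 1)
  exact ⟨h3, by nlinarith⟩

lemma two_ninths_le_eval_recipPoly (hs : 2 ≤ s) (ht0 : 0 ≤ t) (ht2 : t ≤ 2) :
    2 / 9 ≤ (recipPoly s).eval t := by
  have h1 := (eval_recipPoly_bounds (by linarith) ht0 (ht2.trans hs)).1
  have h2 := (eval_recipPoly_mem hs ht0 (ht2.trans hs)).1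
  nlinarith

lemma eval_intervalPoly_mem_Icc (hd : 1 ≤ d) (hα0 : 0 < α) (hα1 : α ≤ 1) (hs : 2 ≤ s)
    (ht0 : 0 ≤ t) (ht2 : t ≤ 2) :
    0 ≤ (intervalPoly c s d α).eval t ∧ (intervalPoly c s d α).eval t ≤ 1 := by
  obtain ⟨hu0, hu1⟩ := eval_recipPoly_mem hs ht0 (ht2.trans hs)
  rw [intervalPoly_eq c s d hα0 hα1]
  simp only [Polynomial.eval_mul, Polynomial.eval_pow, Polynomial.eval_comp]
  obtain ⟨h1, h2⟩ := eval_cutoffPoly_mem_Icc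
    (K := c * (c * (d + ⌈Real.logb 2 (1 / α)⌉₊) + d + ⌈Real.logb 2 (1 / α)⌉₊)) hs ht0 ht2
  have h3 := pow_mul_eval_invPowPoly_le_one (D := c * (d + ⌈Real.logb 2 (1 / α)⌉₊)) hd hu0 hu1
  have h4 := eval_invPowPoly_nonneg (D := c * (d + ⌈Real.logb 2 (1 / α)⌉₊)) hd hu1
  exact ⟨by positivity, mul_le_one₀ h3 h1 h2⟩

lemma one_sub_le_eval_intervalPoly (hc : Admissible c) (hd : 1 ≤ d) (hα0 : 0 < α) (hα1 : α ≤ 1)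
    (hs : 2 ≤ s) (ht0 : 0 ≤ t) (ht1 : t ≤ 1) :
    1 - α ≤ (intervalPoly c s d α).eval t := by
  have hα := half_pow_ceil_logb_le hα0
  rw [intervalPoly_eq c s d hα0 hα1]
  set l := ⌈Real.logb 2 (1 / α)⌉₊
  set D := c * (d + l) with hD
  set K := c * (D + d + l) with hK
  obtain ⟨hu0, hu1⟩ := eval_recipPoly_mem hs ht0 (by linarith)
  simp only [Polynomial.eval_mul, Polynomial.eval_pow, Polynomial.eval_comp]
  set u := (recipPoly s).eval t with hu
  have hP1 := (eval_cutoffPoly_mem_Icc (K := K) hs ht0 (by linarith)).2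
  have hP := one_sub_le_eval_cutoffPoly (K := K) hs ht0 ht1
  have hG1 := pow_mul_eval_invPowPoly_le_one (D := D) hd hu0 hu1
  have hG := one_sub_le_pow_mul_eval_invPowPoly (D := D) hd
    (two_ninths_le_eval_recipPoly hs ht0 (by linarith)) hu1
  rw [← hu] at hG
  -- The hypothesis d ≥ 1 provides the spare factor 1/2, so that two errors of this size add up to
  -- α.
  have half : (1 / 2 : ℝ) ^ (d + l) ≤ α / 2 := by
    calc (1 / 2 : ℝ) ^ (d + l) ≤ (1 / 2) ^ (l + 1) :=
          pow_le_pow_of_le_one (by norm_num) (by norm_num) (by omega)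
      _ = (1 / 2) ^ l / 2 := by ring
      _ ≤ _ := by linarith
  -- The constant 18 in `Admissible` is 2 · 9: it absorbs 9^d and still leaves 2^(-(d+l)).
  have hA : (7 / 8 : ℝ) ^ D * 9 ^ d ≤ α / 2 := by
    refine le_trans ?_ half
    calc (7 / 8 : ℝ) ^ D * 9 ^ d ≤ (1 / 18) ^ (d + l) * 9 ^ (d + l) := by
          rw [hD, pow_mul]
          gcongr
          · exact hc.series_le
          · norm_num
          · omega
      _ = (1 / 2) ^ (d + l) := by rw [← mul_pow]; norm_num
  have hB : Real.exp (-(Real.exp (-7) / 50)) ^ K ≤ α / 2 := by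
    refine le_trans ?_ half
    rw [hK, pow_mul]
    calc _ ≤ (1 / 2 : ℝ) ^ (D + d + l) := by
          gcongr
          exact hc.tail_le
      _ ≤ _ := pow_le_pow_of_le_one (by norm_num) (by norm_num) (by omega)
  -- For G, P ≤ 1, (1-G)(1-P) ≥ 0 gives GP ≥ G + P - 1.
  nlinarith [mul_nonneg (sub_nonneg.2 hG1) (sub_nonneg.2 hP1)]

/-- Three factors: (tu)^d ≤ 1 because (t+1)u ≤ 1; the truncated series is at most 2^(D+d); and K is
chosen so that the cutoff is at most 2^(-(D+d+l)), leaving 2^(-l) ≤ α. -/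
lemma pow_mul_eval_intervalPoly_le (hc : Admissible c) (hd : 1 ≤ d) (hα0 : 0 < α) (hα1 : α ≤ 1)
    (hs : 2 ≤ s) (ht2 : 2 ≤ t) (hts : t ≤ s) :
    0 ≤ (intervalPoly c s d α).eval t ∧ t ^ d * (intervalPoly c s d α).eval t ≤ α := by
  have hα := half_pow_ceil_logb_le hα0
  rw [intervalPoly_eq c s d hα0 hα1]
  set l := ⌈Real.logb 2 (1 / α)⌉₊
  set D := c * (d + l) with hD
  set K := c * (D + d + l) with hK
  obtain ⟨hu0, hu1⟩ := eval_recipPoly_mem hs (by linarith) hts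
  have hut := (eval_recipPoly_bounds (by linarith) (by linarith) hts).2
  simp only [Polynomial.eval_mul, Polynomial.eval_pow, Polynomial.eval_comp]
  set u := (recipPoly s).eval t with hu
  obtain ⟨hP0, hP⟩ := abs_eval_cutoffPoly_le (K := K) hs ht2 hts
  have hI0 := eval_invPowPoly_nonneg (D := D) hd hu1
  have hI := eval_invPowPoly_le (D := D) hd hu0.le hu1
  refine ⟨by positivity, ?_⟩
  have hB : Real.exp (-(Real.exp (-7) / 50)) ^ K ≤ (1 / 2) ^ (D + d + l) := by
    rw [hK, pow_mul]
    gcongr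
    exact hc.tail_le
  have htu : (t * u) ^ d ≤ 1 := pow_le_one₀ (by positivity) (by nlinarith)
  calc t ^ d * (u ^ d * (invPowPoly d D).eval u * (cutoffPoly s K).eval t)
      = (t * u) ^ d * ((invPowPoly d D).eval u * (cutoffPoly s K).eval t) := by ring
    _ ≤ 1 * (2 ^ (D + d) * (1 / 2) ^ (D + d + l)) := by
        gcongr
        exact hP.trans hB
    _ = (1 / 2) ^ l := by
        rw [one_mul, pow_add _ (D + d) l, ← mul_assoc, ← mul_pow]; norm_num
    _ ≤ α := hα

lemma natDegree_intervalPoly_le (c : ℕ) (s : ℝ) (d : ℕ) (hα0 : 0 < α) (hα1 : α ≤ 1) :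
    (intervalPoly c s d α).natDegree ≤
      (d + c * (d + ⌈Real.logb 2 (1 / α)⌉₊)) * ⌊√(2 * s)⌋₊ +
        c * (c * (d + ⌈Real.logb 2 (1 / α)⌉₊) + d + ⌈Real.logb 2 (1 / α)⌉₊) * ⌈√s⌉₊ := by
  rw [intervalPoly_eq c s d hα0 hα1]
  refine Polynomial.natDegree_mul_le.trans (add_le_add ?_ (natDegree_cutoffPoly_le _ _))
  refine Polynomial.natDegree_mul_le.trans ?_
  rw [add_mul]
  refine add_le_add ?_ ?_
  · exact Polynomial.natDegree_pow_le.trans (Nat.mul_le_mul_left _ (natDegree_recipPoly_le s))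
  · exact Polynomial.natDegree_comp_le.trans
      (Nat.mul_le_mul (natDegree_invPowPoly_le _ _) (natDegree_recipPoly_le s))

end interval

/-! ### The multiplier -/

lemma multiplier_zero_eq {c n e : ℕ} {δ : ℝ} (hn : 0 < n) : multiplier c n 0 δ e =
    Polynomial.C ((cheb ⌈√(n : ℝ)⌉₊).eval (1 + 1 / (n : ℝ)) ^ ⌈Real.logb 2 (1 / δ)⌉₊)⁻¹ *
      (cheb ⌈√(n : ℝ)⌉₊).comp
        (Polynomial.C (1 + 1 / (n : ℝ)) - Polynomial.C (1 / (n : ℝ)) * Polynomial.X) ^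
          ⌈Real.logb 2 (1 / δ)⌉₊ := by
  rw [multiplier, if_neg (by omega), if_pos rfl]
  simp [Polynomial.eval_comp]

lemma two_le_eval_cheb_ceil_sqrt {n : ℕ} (hn : 0 < n) :
    2 ≤ (cheb ⌈√(n : ℝ)⌉₊).eval (1 + 1 / (n : ℝ)) := by
  have hn' : (0 : ℝ) < n := by exact_mod_cast hn
  have h := one_add_sq_mul_le_eval_cheb ⌈√(n : ℝ)⌉₊ (x := 1 / (n : ℝ)) (by positivity)
  have h2 : (n : ℝ) ≤ (⌈√(n : ℝ)⌉₊ : ℝ) ^ 2 :=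
    (Real.sqrt_le_left (by positivity)).1 (Nat.le_ceil _)
  have h3 : 1 ≤ (⌈√(n : ℝ)⌉₊ : ℝ) ^ 2 * (1 / n) := by
    rwa [mul_one_div, le_div_iff₀ hn', one_mul]
  linarith

lemma eval_zero_multiplier_zero {c n e : ℕ} {δ : ℝ} (hn : 0 < n) :
    (multiplier c n 0 δ e).eval 0 = 1 := by
  have h := two_le_eval_cheb_ceil_sqrt hn
  rw [multiplier_zero_eq hn]
  simp only [Polynomial.eval_mul, Polynomial.eval_C, Polynomial.eval_pow, Polynomial.eval_comp,
    Polynomial.eval_sub, Polynomial.eval_X, mul_zero, sub_zero]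
  exact inv_mul_cancel₀ (by positivity)

lemma abs_eval_multiplier_zero_le {c n e : ℕ} {δ t : ℝ} (hδ : 0 < δ) (ht1 : 1 ≤ t)
    (htn : t ≤ n) : |(multiplier c n 0 δ e).eval t| ≤ δ := by
  have hn' : (0 : ℝ) < n := by linarith
  have hn : 0 < n := by exact_mod_cast hn'
  have h := two_le_eval_cheb_ceil_sqrt hn
  rw [multiplier_zero_eq hn]
  simp only [Polynomial.eval_mul, Polynomial.eval_C, Polynomial.eval_pow, Polynomial.eval_comp,
    Polynomial.eval_sub, Polynomial.eval_X]
  have h1 : |(cheb ⌈√(n : ℝ)⌉₊).eval (1 + 1 / (n : ℝ) - 1 / n * t)| ≤ 1 := by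
    apply abs_eval_cheb_le_one
    have a : 0 ≤ (t - 1) / n := div_nonneg (by linarith) hn'.le
    have b : (t - 1) / n ≤ 1 := (div_le_one hn').2 (by linarith)
    have e : 1 + 1 / (n : ℝ) - 1 / n * t = 1 - (t - 1) / n := by ring
    rw [e, abs_le]
    constructor <;> linarith
  set l := ⌈Real.logb 2 (1 / δ)⌉₊
  rw [abs_mul, abs_pow, ← inv_pow, abs_pow]
  calc _ ≤ (1 / 2 : ℝ) ^ l * 1 := by
        gcongr
        · rw [abs_inv, one_div 2, abs_of_pos (lt_of_lt_of_le two_pos h)]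
          exact inv_anti₀ two_pos h
        · exact pow_le_one₀ (abs_nonneg _) h1
    _ ≤ δ := by rw [mul_one]; exact half_pow_ceil_logb_le hδ

lemma natDegree_multiplier_zero_le {c n e : ℕ} {δ : ℝ} (hn : 0 < n) :
    (multiplier c n 0 δ e).natDegree ≤ ⌈Real.logb 2 (1 / δ)⌉₊ * ⌈√(n : ℝ)⌉₊ := by
  rw [multiplier_zero_eq hn]
  refine (Polynomial.natDegree_C_mul_le _ _).trans (Polynomial.natDegree_pow_le.trans ?_)
  refine Nat.mul_le_mul_left _ (Polynomial.natDegree_comp_le.trans ?_)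
  rw [natDegree_cheb]
  have h2 : (Polynomial.C (1 + 1 / (n : ℝ)) - Polynomial.C (1 / (n : ℝ)) * Polynomial.X :
      Polynomial ℝ).natDegree ≤ 1 := by
    compute_degree
  exact (Nat.mul_le_mul_left _ h2).trans (mul_one _).le

lemma eval_multiplier_pos {c n m e : ℕ} {δ : ℝ} (hm : 0 < m) (hn : 2 * m < n) (t : ℝ) :
    (multiplier c n m δ e).eval t =
      (intervalPoly c ((n : ℝ) / m) (max e 1) (δ / (4 * Real.exp 1) ^ (max e 1 + 1))).eval
        (t / m) := by
  rw [multiplier, if_neg (by omega), if_neg (by omega)]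
  simp [Polynomial.eval_comp, div_eq_inv_mul]

lemma natDegree_multiplier_pos_le {c n m e : ℕ} {δ : ℝ} (hm : 0 < m) (hn : 2 * m < n) :
    (multiplier c n m δ e).natDegree ≤
      (intervalPoly c ((n : ℝ) / m) (max e 1)
        (δ / (4 * Real.exp 1) ^ (max e 1 + 1))).natDegree := by
  rw [multiplier, if_neg (by omega), if_neg (by omega)]
  refine Polynomial.natDegree_comp_le.trans ?_
  have h2 : (Polynomial.C (1 / (m : ℝ)) * Polynomial.X : Polynomial ℝ).natDegree ≤ 1 := by
    compute_degree
  exact (Nat.mul_le_mul_left _ h2).trans (mul_one _).le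

lemma one_lt_logb {δ : ℝ} (h0 : 0 < δ) (h1 : δ < 1 / 2) : 1 < Real.logb 2 (1 / δ) := by
  rw [Real.lt_logb_iff_rpow_lt (by norm_num) (by positivity), Real.rpow_one, lt_div_iff₀ h0]
  linarith

lemma decay_pos_le {δ : ℝ} (h0 : 0 < δ) (h1 : δ < 1 / 2) (d : ℕ) :
    0 < δ / (4 * Real.exp 1) ^ (d + 1) ∧ δ / (4 * Real.exp 1) ^ (d + 1) ≤ δ / 4 := by
  have he := Real.add_one_le_exp (1 : ℝ)
  refine ⟨by positivity, ?_⟩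
  gcongr
  calc (4 : ℝ) ≤ (4 * Real.exp 1) ^ 1 := by linarith
    _ ≤ _ := pow_le_pow_right₀ (by linarith) (by omega)

/-- Since 4e < 16, the power of 4e contributes at most 4(d+1) and the rounding at most 1; together
at most 9d, as d ≥ 1. -/
lemma ceil_logb_decay_le {δ : ℝ} (h0 : 0 < δ) (h1 : δ < 1 / 2) {d : ℕ} (hd : 1 ≤ d) :
    (⌈Real.logb 2 (1 / (δ / (4 * Real.exp 1) ^ (d + 1)))⌉₊ : ℝ) ≤
      9 * d + Real.logb 2 (1 / δ) := by
  have he := Real.exp_one_lt_d9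
  have hlog : Real.logb 2 (4 * Real.exp 1) ≤ 4 := by
    rw [Real.logb_le_iff_le_rpow (by norm_num) (by positivity)]
    norm_num
    linarith
  have heq : Real.logb 2 (1 / (δ / (4 * Real.exp 1) ^ (d + 1))) =
      Real.logb 2 (1 / δ) + (d + 1) * Real.logb 2 (4 * Real.exp 1) := by
    rw [show 1 / (δ / (4 * Real.exp 1) ^ (d + 1)) = 1 / δ * (4 * Real.exp 1) ^ (d + 1) by
      field_simp, Real.logb_mul (by positivity) (by positivity), Real.logb_pow]
    push_cast; ring
  have hL := one_lt_logb h0 h1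
  have hle : 0 ≤ Real.logb 2 (4 * Real.exp 1) := by
    apply Real.logb_nonneg (by norm_num)
    linarith [Real.add_one_le_exp (1 : ℝ)]
  have hd' : (1 : ℝ) ≤ d := by exact_mod_cast hd
  have hub : Real.logb 2 (1 / (δ / (4 * Real.exp 1) ^ (d + 1))) ≤
      Real.logb 2 (1 / δ) + (d + 1) * 4 := by
    rw [heq]; gcongr
  have := Nat.ceil_lt_add_one (a := Real.logb 2 (1 / (δ / (4 * Real.exp 1) ^ (d + 1))))
    (by rw [heq]; positivity)
  linarith

/-- The constant is 140 = 35 · 2 · 2: 35 = 1 + 1 + 11 + 22 collects the coefficients of √s, one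
factor 2 pays for √(2s) and the ceiling of √s, and the other for replacing m by m + 1. -/
lemma natDegree_multiplier_add_le {c n m e : ℕ} {δ A : ℝ} (hc : 1 ≤ c) (hm : 0 < m)
    (hn : 2 * m < n) (h0 : 0 < δ) (h1 : δ < 1 / 2) (hA : e + Real.logb 2 (1 / δ) ≤ A) :
    ((e + (multiplier c n m δ e).natDegree : ℕ) : ℝ) ≤
      140 * c ^ 2 * √((n : ℝ) / ((m : ℝ) + 1)) * A := by
  have hL := one_lt_logb h0 h1
  set d := max e 1 with hd
  have hd1 : 1 ≤ d := le_max_right _ _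
  have hdA : (d : ℝ) ≤ A := by
    rw [hd]; push_cast
    -- If e = 0 then d = 1, which is still at most A because log(1/δ) > 1.
    exact max_le (by linarith) (by linarith [(Nat.cast_nonneg e : (0 : ℝ) ≤ e)])
  have hed : (e : ℝ) ≤ d := by exact_mod_cast le_max_left e 1
  have hd1' : (1 : ℝ) ≤ d := by exact_mod_cast hd1
  obtain ⟨hα0, hα1⟩ := decay_pos_le h0 h1 d
  have hl := ceil_logb_decay_le h0 h1 hd1
  have hdeg := (natDegree_multiplier_pos_le (c := c) (e := e) (δ := δ) hm hn).trans
    (natDegree_intervalPoly_le c ((n : ℝ) / m) d hα0 (by linarith))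
  set l := ⌈Real.logb 2 (1 / (δ / (4 * Real.exp 1) ^ (d + 1)))⌉₊
  have hdeg' : ((multiplier c n m δ e).natDegree : ℝ) ≤
      (d + c * (d + l)) * ⌊√(2 * ((n : ℝ) / m))⌋₊ +
        c * (c * (d + l) + d + l) * ⌈√((n : ℝ) / m)⌉₊ := by exact_mod_cast hdeg
  have hm' : (1 : ℝ) ≤ m := by exact_mod_cast hm
  have hn' : (2 : ℝ) * m < n := by exact_mod_cast hn
  have hc' : (1 : ℝ) ≤ c := by exact_mod_cast hc
  have hs : 2 ≤ (n : ℝ) / m := by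
    rw [le_div_iff₀ (by linarith)]; linarith
  set s := (n : ℝ) / m with hsdef
  have hs1 : 1 ≤ √s := Real.one_le_sqrt.2 (by linarith)
  have hr1 : (⌊√(2 * s)⌋₊ : ℝ) ≤ 2 * √s := by
    refine (Nat.floor_le (Real.sqrt_nonneg _)).trans ?_
    rw [Real.sqrt_le_left (by positivity), mul_pow, Real.sq_sqrt (by linarith)]
    linarith
  have hr2 : (⌈√s⌉₊ : ℝ) ≤ 2 * √s := by
    have := Nat.ceil_lt_add_one (Real.sqrt_nonneg s)
    linarith
  have hr3 : √s ≤ 2 * √((n : ℝ) / ((m : ℝ) + 1)) := by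
    rw [Real.sqrt_le_left (by positivity), mul_pow, Real.sq_sqrt (by positivity), hsdef,
      ← mul_div_assoc, div_le_div_iff₀ (by linarith) (by linarith)]
    nlinarith
  have hA0 : 0 ≤ A := by linarith
  have hDl : (d : ℝ) + l ≤ 11 * A := by
    have : (l : ℝ) + d ≤ 10 * d + Real.logb 2 (1 / δ) := by linarith
    linarith
  have hD : (c : ℝ) * (d + l) ≤ 11 * c * A := by nlinarith
  have hK : (c : ℝ) * (c * (d + l) + d + l) ≤ 22 * c ^ 2 * A := by
    have : (c : ℝ) * (d + l) + d + l ≤ 22 * c * A := by nlinarith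
    calc _ ≤ (c : ℝ) * (22 * c * A) := by gcongr
      _ = _ := by ring
  have hcc : (c : ℝ) ≤ c ^ 2 := by nlinarith
  have hsum : (d : ℝ) + (d + c * (d + l)) + c * (c * (d + l) + d + l) ≤ 35 * c ^ 2 * A := by
    have e1 : (c : ℝ) * A ≤ c ^ 2 * A := by gcongr
    have e2 : A ≤ c * A := by nlinarith
    linarith
  push_cast
  calc (e : ℝ) + (multiplier c n m δ e).natDegree
      ≤ d * (2 * √s) + ((d + c * (d + l)) * (2 * √s) +
        c * (c * (d + l) + d + l) * (2 * √s)) := by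
        refine add_le_add
          (hed.trans (le_mul_of_one_le_right (by linarith) (by linarith))) (hdeg'.trans ?_)
        gcongr
    _ = (d + (d + c * (d + l)) + c * (c * (d + l) + d + l)) * (2 * √s) := by ring
    _ ≤ 35 * c ^ 2 * A * (2 * (2 * √((n : ℝ) / ((m : ℝ) + 1)))) := by gcongr
    _ = _ := by ring

end ExtensionThm

namespace ExtensionThm

open Finset

/-! ### Points of the cube and interpolation -/

/-- The characteristic vector of a set of coordinates. -/
def indVec {N : ℕ} (S : Finset (Fin N)) : Fin N → ℝ := fun i => if i ∈ S then 1 else 0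

variable {N : ℕ}

lemma sum_indVec (S : Finset (Fin N)) : ∑ i, indVec S i = #S := by
  simp [indVec]

lemma prod_indVec (A S : Finset (Fin N)) :
    ∏ i ∈ S, indVec A i = if S ⊆ A then 1 else 0 := by
  simp only [indVec]
  rw [prod_ite_zero, prod_const_one]
  rfl

lemma indVec_mem_cubeLE {S : Finset (Fin N)} {k : ℕ} : indVec S ∈ cubeLE N k ↔ #S ≤ k := by
  have h : ∀ i, indVec S i = 0 ∨ indVec S i = 1 := fun i => by
    unfold indVec
    split_ifs <;> simp
  simp only [cubeLE, Set.mem_ofPred_eq, sum_indVec, Nat.cast_le]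
  exact ⟨fun H => H.2, fun H => ⟨h, H⟩⟩

lemma exists_eq_indVec {x : Fin N → ℝ} {k : ℕ} (hx : x ∈ cubeLE N k) :
    ∃ S : Finset (Fin N), #S ≤ k ∧ x = indVec S := by
  classical
  have hxS : x = indVec (univ.filter fun i => x i = 1) := by
    funext i
    rcases hx.1 i with h | h <;> simp [indVec, h]
  refine ⟨_, ?_, hxS⟩
  rw [hxS] at hx
  exact indVec_mem_cubeLE.1 hx

/-- At `indVec A` the monomial of S is the indicator of S ⊆ A. The correction of level k + 1
therefore leaves smaller sets alone, and on a set of size k + 1 only S = A contributes. -/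
lemma eval_interpolant (φ : MvPolynomial (Fin N) ℝ) (k : ℕ) (A : Finset (Fin N)) (hA : #A ≤ k) :
    MvPolynomial.eval (indVec A) (interpolant φ k) = MvPolynomial.eval (indVec A) φ := by
  induction k with
  | zero =>
    have : A = ∅ := card_eq_zero.1 (by omega)
    subst this
    have h0 : indVec (∅ : Finset (Fin N)) = 0 := by funext i; simp [indVec]
    simp only [h0, interpolant, MvPolynomial.eval_C]
  | succ k ih =>
    rw [interpolant, map_add, map_sum]
    simp only [map_mul, MvPolynomial.eval_C, map_prod, MvPolynomial.eval_X, prod_indVec]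
    rcases Nat.lt_or_ge k #A with hk | hk
    · have hAk : #A = k + 1 := by omega
      rw [sum_eq_single A]
      · rw [if_pos Subset.rfl, mul_one]
        change _ + MvPolynomial.eval (indVec A) _ = _
        rw [map_sub]; ring
      · intro S hS hSA
        rw [if_neg, mul_zero]
        intro hsub
        exact hSA (eq_of_subset_of_card_le hsub (by rw [(mem_powersetCard.1 hS).2, hAk]))
      · intro h
        exact absurd (mem_powersetCard.2 ⟨subset_univ _, hAk⟩) h
    · rw [ih hk, add_eq_left]
      refine sum_eq_zero fun S hS => ?_
      rw [if_neg, mul_zero]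
      intro hsub
      have := card_le_card hsub
      rw [(mem_powersetCard.1 hS).2] at this
      omega

lemma totalDegree_interpolant_le (φ : MvPolynomial (Fin N) ℝ) (k : ℕ) :
    (interpolant φ k).totalDegree ≤ k := by
  induction k with
  | zero => simp [interpolant]
  | succ k ih =>
    rw [interpolant]
    refine (MvPolynomial.totalDegree_add _ _).trans (max_le (by omega) ?_)
    refine MvPolynomial.totalDegree_finsetSum_le fun S hS => ?_
    refine (MvPolynomial.totalDegree_mul _ _).trans ?_
    rw [MvPolynomial.totalDegree_C, zero_add]
    refine (MvPolynomial.totalDegree_finsetProd _ _).trans ?_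
    simp [(mem_powersetCard.1 hS).2]

lemma eval_lowDegree (φ : MvPolynomial (Fin N) ℝ) (k : ℕ) (A : Finset (Fin N)) (hA : #A ≤ k) :
    MvPolynomial.eval (indVec A) (lowDegree k φ) = MvPolynomial.eval (indVec A) φ := by
  unfold lowDegree
  split_ifs
  · rfl
  · exact eval_interpolant φ k A hA

lemma totalDegree_lowDegree_le (φ : MvPolynomial (Fin N) ℝ) (k : ℕ) :
    (lowDegree k φ).totalDegree ≤ k ∧ (lowDegree k φ).totalDegree ≤ φ.totalDegree := by
  unfold lowDegree
  split_ifs with h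
  · exact ⟨h, le_rfl⟩
  · have := totalDegree_interpolant_le φ k
    omega

lemma exists_eval_eq (F : Finset (Fin N) → ℝ) :
    ∃ p : MvPolynomial (Fin N) ℝ, ∀ A, MvPolynomial.eval (indVec A) p = F A := by
  refine ⟨∑ S, MvPolynomial.C (F S) *
    ∏ i, (if i ∈ S then MvPolynomial.X i else 1 - MvPolynomial.X i), fun A => ?_⟩
  rw [map_sum, sum_eq_single A]
  · rw [map_mul, MvPolynomial.eval_C, map_prod, prod_eq_one, mul_one]
    intro i _
    by_cases hi : i ∈ A <;> simp [hi, indVec]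
  · intro S _ hS
    rw [map_mul, map_prod]
    obtain ⟨i, hi⟩ : ∃ i, ¬(i ∈ S ↔ i ∈ A) := by
      by_contra! h
      exact hS (Finset.ext h)
    rw [prod_eq_zero (mem_univ i), mul_zero]
    by_cases h1 : i ∈ S <;> by_cases h2 : i ∈ A <;> simp_all [indVec]
  · simp

/-! ### Symmetrization -/

lemma eval_indVec (φ : MvPolynomial (Fin N) ℝ) (A : Finset (Fin N)) :
    MvPolynomial.eval (indVec A) φ =
      ∑ v ∈ φ.support, φ.coeff v * if v.support ⊆ A then 1 else 0 := by
  rw [MvPolynomial.eval_eq]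
  refine sum_congr rfl fun v _ => ?_
  rw [← prod_indVec]
  congr 1
  refine prod_congr rfl fun i hi => ?_
  have : v i ≠ 0 := Finsupp.mem_support_iff.1 hi
  unfold indVec
  split_ifs <;> simp [this]

lemma card_support_le_totalDegree {φ : MvPolynomial (Fin N) ℝ} {v : Fin N →₀ ℕ}
    (hv : v ∈ φ.support) : #v.support ≤ φ.totalDegree := by
  refine le_trans ?_ (MvPolynomial.le_totalDegree hv)
  rw [card_eq_sum_ones]
  exact sum_le_sum fun i hi => Nat.one_le_iff_ne_zero.2 (Finsupp.mem_support_iff.1 hi)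

lemma choose_mul_descFactorial {k j r : ℕ} (hrj : r ≤ j) :
    k.choose j * j.descFactorial r = k.descFactorial r * (k - r).choose (j - r) := by
  rw [Nat.descFactorial_eq_factorial_mul_choose, Nat.descFactorial_eq_factorial_mul_choose]
  have := Nat.choose_mul (n := k) hrj
  calc _ = r.factorial * (k.choose j * j.choose r) := by ring
    _ = _ := by rw [this]; ring

/-- Averaging a polynomial over the subsets of `A` of a given size yields a univariate polynomial
of no larger degree. -/
lemma exists_symmetrization (φ : MvPolynomial (Fin N) ℝ) (A : Finset (Fin N)) :
    ∃ g : Polynomial ℝ, g.natDegree ≤ φ.totalDegree ∧ ∀ j ≤ #A,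
      ((#A).choose j : ℝ) * g.eval (j : ℝ) =
        ∑ S ∈ powersetCard j A, MvPolynomial.eval (indVec S) φ := by
  -- With a = #A and r = #v.support, a uniformly random j-subset of A contains v.support ⊆ A with
  -- probability j(j-1)⋯(j-r+1) / (a(a-1)⋯(a-r+1)), a polynomial of degree r in j.
  refine ⟨∑ v ∈ φ.support with v.support ⊆ A,
    Polynomial.C (φ.coeff v / ((#A).descFactorial #v.support : ℝ)) *
      descPochhammer ℝ #v.support, ?_, fun j hj => ?_⟩
  · refine Polynomial.natDegree_sum_le_of_forall_le _ _ fun v hv => ?_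
    refine (Polynomial.natDegree_C_mul_le _ _).trans ?_
    rw [descPochhammer_natDegree]
    exact card_support_le_totalDegree (mem_filter.1 hv).1
  · simp only [eval_indVec]
    rw [sum_comm, Polynomial.eval_finsetSum, mul_sum, sum_filter]
    refine sum_congr rfl fun v _ => ?_
    rw [← mul_sum, sum_boole]
    split_ifs with hv
    · have hvA := card_le_card hv
      have hne : ((#A).descFactorial #v.support : ℝ) ≠ 0 := by
        exact_mod_cast (Nat.descFactorial_pos.2 hvA).ne'
      rw [Polynomial.eval_mul, Polynomial.eval_C, descPochhammer_eval_eq_descFactorial]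
      rcases le_or_gt #v.support j with hle | hlt
      · rw [card_filter_powersetCard_subset _ _ _ hv hle]
        have h : ((#A).choose j : ℝ) * (j.descFactorial #v.support : ℝ) =
            (#A).descFactorial #v.support * (#A - #v.support).choose (j - #v.support) := by
          exact_mod_cast choose_mul_descFactorial hle
        field_simp
        linear_combination (φ.coeff v) * h
      -- For j < r both sides vanish: a j-subset is too small to contain the support.
      · rw [Nat.descFactorial_eq_zero_iff_lt.2 hlt, filter_eq_empty_iff.2]
        · simp
        · intro S hS hsub
          have := card_le_card hsub
          rw [(mem_powersetCard.1 hS).2] at this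
          omega
    · rw [filter_eq_empty_iff.2]
      · simp
      · intro S hS hsub
        exact hv (hsub.trans (mem_powersetCard.1 hS).1)

/-! ### Growth of a polynomial beyond the points where it is bounded -/

lemma prod_erase_abs_sub {d i : ℕ} (hi : i ≤ d) :
    ∏ j ∈ (range (d + 1)).erase i, |(i : ℝ) - j| = (i.factorial * (d - i).factorial : ℕ) := by
  have h1 : ∏ j ∈ (range (d + 1)).erase i, |(i : ℝ) - j| =
      ∏ j ∈ range (d + 1), if j = i then 1 else |(i : ℝ) - j| := by
    rw [← mul_prod_erase (range (d + 1)) _ (mem_range.2 (Nat.lt_succ_of_le hi)), if_pos rfl,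
      one_mul]
    exact prod_congr rfl fun j hj => by rw [if_neg (mem_erase.1 hj).1]
  rw [h1, show d + 1 = i + ((d - i) + 1) by omega, prod_range_add, prod_range_succ']
  simp only [add_zero, if_true, mul_one]
  push_cast
  congr 1
  · rw [← prod_range_reflect, ← prod_range_add_one_eq_factorial]
    push_cast
    refine prod_congr rfl fun j hj => ?_
    have hj' := mem_range.1 hj
    rw [if_neg (by omega), Nat.sub_sub, Nat.cast_sub (by omega)]
    push_cast
    rw [abs_of_nonneg (by linarith [(Nat.cast_nonneg j : (0 : ℝ) ≤ j)])]
    ring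
  · rw [← prod_range_add_one_eq_factorial]
    push_cast
    refine prod_congr rfl fun j _ => ?_
    rw [if_neg (by omega), abs_sub_comm, abs_of_nonneg]
    · ring
    · linarith [(Nat.cast_nonneg j : (0 : ℝ) ≤ j)]

/-- Each node satisfies 0 ≤ jh ≤ x, so each Lagrange factor is at most (x/h)/|i-j|; the product of
the |i-j| is i!(d-i)!. -/
lemma abs_eval_basis_le {d i : ℕ} (hi : i ≤ d) {h x : ℝ} (hh : 0 < h) (hx : d * h ≤ x) :
    |(Lagrange.basis (range (d + 1)) (fun j : ℕ => (j : ℝ) * h) i).eval x| ≤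
      (x / h) ^ d / (i.factorial * (d - i).factorial : ℕ) := by
  rw [← prod_erase_abs_sub hi, Lagrange.basis, Polynomial.eval_prod, abs_prod]
  have hcard : #((range (d + 1)).erase i) = d := by
    rw [card_erase_of_mem (mem_range.2 (Nat.lt_succ_of_le hi)), card_range, Nat.add_one_sub_one]
  have hpow : (x / h) ^ d = ∏ _j ∈ (range (d + 1)).erase i, x / h := by
    rw [prod_const, hcard]
  rw [hpow, ← prod_div_distrib]
  refine prod_le_prod (fun _ _ => abs_nonneg _) fun j hj => ?_
  have hjd : (j : ℝ) ≤ d := by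
    exact_mod_cast Nat.lt_succ_iff.1 (mem_range.1 (mem_erase.1 hj).2)
  have hj0 : (0 : ℝ) ≤ j * h := by positivity
  have hjx : (j : ℝ) * h ≤ x := (mul_le_mul_of_nonneg_right hjd hh.le).trans hx
  have hij : 0 < |(i : ℝ) - j| :=
    abs_pos.2 (sub_ne_zero.2 (Nat.cast_injective.ne (mem_erase.1 hj).1.symm))
  rw [Lagrange.basisDivisor]
  simp only [Polynomial.eval_mul, Polynomial.eval_C, Polynomial.eval_sub, Polynomial.eval_X]
  rw [← sub_mul, abs_mul, abs_inv, abs_mul, abs_of_pos hh, abs_of_nonneg (sub_nonneg.2 hjx),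
    div_div, ← div_eq_inv_mul, mul_comm h]
  gcongr
  linarith

/-- Summing the bounds on the basis polynomials uses ∑ 1/(i!(d-i)!) = 2^d/d!. -/
lemma abs_eval_le_of_equispaced {g : Polynomial ℝ} {d : ℕ} (hg : g.natDegree ≤ d) {h B x : ℝ}
    (hh : 0 < h) (hB : ∀ j : ℕ, j ≤ d → |g.eval (j * h)| ≤ B) (hx : d * h ≤ x) :
    |g.eval x| ≤ B * (2 * (x / h)) ^ d / d.factorial := by
  have hinj : Set.InjOn (fun j : ℕ => (j : ℝ) * h) (range (d + 1)) := fun a _ b _ hab => by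
    exact_mod_cast mul_right_cancel₀ hh.ne' hab
  have hdeg : g.degree < #(range (d + 1)) := by
    rw [card_range]
    exact Polynomial.degree_le_natDegree.trans_lt (by exact_mod_cast Nat.lt_succ_of_le hg)
  have hB0 : 0 ≤ B := (abs_nonneg _).trans (hB 0 (Nat.zero_le d))
  have hx0 : 0 ≤ x := le_trans (by positivity) hx
  rw [Lagrange.eq_interpolate hinj hdeg, Lagrange.interpolate_apply, Polynomial.eval_finsetSum]
  refine (abs_sum_le_sum_abs _ _).trans ?_
  calc _ ≤ ∑ i ∈ range (d + 1), B * (x / h) ^ d / d.factorial * d.choose i := by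
        refine sum_le_sum fun i hi => ?_
        have hi' : i ≤ d := Nat.lt_succ_iff.1 (mem_range.1 hi)
        rw [Polynomial.eval_mul, Polynomial.eval_C, abs_mul]
        have e : B * (x / h) ^ d / d.factorial * d.choose i =
            B * ((x / h) ^ d / (i.factorial * (d - i).factorial : ℕ)) := by
          have := Nat.choose_mul_factorial_mul_factorial hi'
          rw [← this]
          have h1 := (Nat.choose_pos hi').ne'
          have h2 := i.factorial_ne_zero
          have h3 := (d - i).factorial_ne_zero
          push_cast
          field_simp
        rw [e]
        exact mul_le_mul (hB i hi') (abs_eval_basis_le hi' hh hx) (abs_nonneg _) hB0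
    _ = _ := by
        rw [← mul_sum]
        have := Nat.sum_range_choose d
        rw [show ∑ i ∈ range (d + 1), (d.choose i : ℝ) = 2 ^ d by exact_mod_cast this, mul_pow]
        ring

lemma abs_eval_indVec_le {φ : MvPolynomial (Fin N) ℝ} {B : ℝ} {d m : ℕ}
    (hd1 : 1 ≤ d) (hdm : d ≤ 2 * m) (hdeg : φ.totalDegree ≤ d)
    (hB : ∀ S : Finset (Fin N), #S ≤ 2 * m → |MvPolynomial.eval (indVec S) φ| ≤ B)
    {A : Finset (Fin N)} (hA : 2 * m ≤ #A) :
    |MvPolynomial.eval (indVec A) φ| ≤ B * (2 * Real.exp 1 * (#A / m)) ^ d := by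
  obtain ⟨g, hgdeg, hg⟩ := exists_symmetrization φ A
  have hgA : g.eval (#A : ℝ) = MvPolynomial.eval (indVec A) φ := by
    have := hg #A le_rfl
    simpa using this
  have hgB : ∀ j ≤ 2 * m, |g.eval (j : ℝ)| ≤ B := by
    intro j hj
    have hjA := hj.trans hA
    have hpos : (0 : ℝ) < (#A).choose j := by exact_mod_cast Nat.choose_pos hjA
    have h1 : |((#A).choose j : ℝ) * g.eval (j : ℝ)| ≤ (#A).choose j * B := by
      rw [hg j hjA]
      refine (abs_sum_le_sum_abs _ _).trans ?_
      have := sum_le_card_nsmul (powersetCard j A)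
        (fun S => |MvPolynomial.eval (indVec S) φ|) B
        (fun S hS => hB S (by rw [(mem_powersetCard.1 hS).2]; exact hj))
      rwa [card_powersetCard, nsmul_eq_mul] at this
    rw [abs_mul, abs_of_pos hpos] at h1
    exact le_of_mul_le_mul_left h1 hpos
  have hB0 : 0 ≤ B := (abs_nonneg _).trans (hgB 0 (Nat.zero_le _))
  -- Integer spacing: the nodes 0, h, …, dh stay within [0,2m], and dh ≥ m because h ≥ 1 and 2m <
  -- d(h+1) ≤ 2dh. With d^d/d! ≤ e^d this gives the base 2e·#A/m.
  set h := 2 * m / d with hh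
  have hh1 : 1 ≤ h := (Nat.one_le_div_iff (by omega)).2 hdm
  have hdh : d * h ≤ 2 * m := Nat.mul_div_le _ _
  have hmdh : m ≤ d * h := by
    have := Nat.lt_mul_div_succ (2 * m) (show 0 < d by omega)
    rw [← hh] at this
    nlinarith
  have hm : 1 ≤ m := by omega
  have key := abs_eval_le_of_equispaced (hgdeg.trans hdeg) (h := h) (x := #A) (B := B)
    (by exact_mod_cast hh1) (fun j hj => by
      have := hgB (j * h) ((Nat.mul_le_mul_right h hj).trans hdh)
      push_cast at this
      exact this) (by exact_mod_cast hdh.trans hA)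
  rw [← hgA]
  refine key.trans ?_
  have hfac : (d : ℝ) ^ d / d.factorial ≤ Real.exp 1 ^ d := by
    rw [← Real.exp_nat_mul, mul_one]
    exact Real.pow_div_factorial_le_exp _ (Nat.cast_nonneg d) d
  have hd0 : (0 : ℝ) < d := by exact_mod_cast hd1
  have hh0 : (0 : ℝ) < h := by exact_mod_cast hh1
  have hm0 : (0 : ℝ) < m := by exact_mod_cast hm
  calc B * (2 * (#A / h : ℝ)) ^ d / d.factorial
      = B * ((2 * (#A / (d * h) : ℝ)) ^ d * ((d : ℝ) ^ d / d.factorial)) := by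
        have : d * (2 * (#A / (d * h) : ℝ)) = 2 * (#A / h : ℝ) := by field_simp
        rw [← this]
        ring
    _ ≤ B * ((2 * (#A / m : ℝ)) ^ d * Real.exp 1 ^ d) := by
        gcongr
        exact_mod_cast hmdh
    _ = _ := by rw [← mul_pow]; ring

/-! ### Polynomials in the Hamming weight -/

lemma eval_aeval_sum_X (q : Polynomial ℝ) (x : Fin N → ℝ) :
    MvPolynomial.eval x (Polynomial.aeval
      (∑ i : Fin N, (MvPolynomial.X i : MvPolynomial (Fin N) ℝ)) q) = q.eval (∑ i, x i) := by
  rw [Polynomial.aeval_def, Polynomial.hom_eval₂]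
  have : (MvPolynomial.eval x).comp (algebraMap ℝ (MvPolynomial (Fin N) ℝ)) = RingHom.id ℝ := by
    ext; simp
  rw [this, Polynomial.eval₂_id, map_sum]
  simp

lemma totalDegree_aeval_sum_X_le (q : Polynomial ℝ) :
    (Polynomial.aeval (∑ i : Fin N, (MvPolynomial.X i : MvPolynomial (Fin N) ℝ))
      q).totalDegree ≤ q.natDegree := by
  rw [Polynomial.aeval_eq_sum_range]
  refine MvPolynomial.totalDegree_finsetSum_le fun i hi => ?_
  refine (MvPolynomial.totalDegree_smul_le _ _).trans ((MvPolynomial.totalDegree_pow _ _).trans ?_)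
  have h1 : (∑ i : Fin N, (MvPolynomial.X i : MvPolynomial (Fin N) ℝ)).totalDegree ≤ 1 :=
    MvPolynomial.totalDegree_finsetSum_le fun i _ => by simp
  have h2 := mem_range.1 hi
  nlinarith

/-! ### The transformation of approximants -/

lemma extendZero_apply_of_le {m n : ℕ} (f : cubeLE N m → ℝ) {A : Finset (Fin N)} (hm : #A ≤ m)
    (hn : indVec A ∈ cubeLE N n) :
    extendZero f n ⟨indVec A, hn⟩ = f ⟨indVec A, indVec_mem_cubeLE.2 hm⟩ :=
  dif_pos _

lemma extendZero_apply_of_lt {m n : ℕ} (f : cubeLE N m → ℝ) {A : Finset (Fin N)} (hm : m < #A)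
    (hn : indVec A ∈ cubeLE N n) : extendZero f n ⟨indVec A, hn⟩ = 0 :=
  dif_neg fun h => absurd (indVec_mem_cubeLE.1 h) (by omega)

lemma exists_approximates {k : ℕ} (F : cubeLE N k → ℝ) {ε : ℝ} (hε : 0 ≤ ε) :
    ∃ p : MvPolynomial (Fin N) ℝ, Approximates p F ε := by
  classical
  obtain ⟨p, hp⟩ := exists_eval_eq
    (fun A => if h : indVec A ∈ cubeLE N k then F ⟨indVec A, h⟩ else 0)
  refine ⟨p, fun ⟨x, hx⟩ => ?_⟩
  obtain ⟨A, _, rfl⟩ := exists_eq_indVec hx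
  simpa [hp, hx] using hε

lemma eval_extendApproximant (c n m : ℕ) (δ : ℝ) (φ : MvPolynomial (Fin N) ℝ)
    (A : Finset (Fin N)) :
    MvPolynomial.eval (indVec A) (extendApproximant c n m δ φ) =
      MvPolynomial.eval (indVec A) (lowDegree (2 * m) φ) *
        (multiplier c n m δ (lowDegree (2 * m) φ).totalDegree).eval (#A : ℝ) := by
  rw [extendApproximant, map_mul, eval_aeval_sum_X, sum_indVec]

lemma totalDegree_extendApproximant_le (c n m : ℕ) (δ : ℝ) (φ : MvPolynomial (Fin N) ℝ) :
    (extendApproximant c n m δ φ).totalDegree ≤ (lowDegree (2 * m) φ).totalDegree +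
      (multiplier c n m δ (lowDegree (2 * m) φ).totalDegree).natDegree :=
  (MvPolynomial.totalDegree_mul _ _).trans (by gcongr; exact totalDegree_aeval_sum_X_le _)

section approximation

variable {c n m : ℕ} {ε δ : ℝ} {f : cubeLE N m → ℝ} {φ : MvPolynomial (Fin N) ℝ}

lemma abs_sub_eval_le (hφ : Approximates φ (extendZero f (2 * m)) ε) {A : Finset (Fin N)}
    (hA : #A ≤ m) : |f ⟨indVec A, indVec_mem_cubeLE.2 hA⟩ -
      MvPolynomial.eval (indVec A) (lowDegree (2 * m) φ)| ≤ ε := by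
  have h := hφ ⟨indVec A, indVec_mem_cubeLE.2 (by omega)⟩
  rwa [extendZero_apply_of_le f hA, ← eval_lowDegree φ (2 * m) A (by omega)] at h

lemma abs_eval_le (hφ : Approximates φ (extendZero f (2 * m)) ε) {A : Finset (Fin N)}
    (hA : m < #A) (hA2 : #A ≤ 2 * m) :
    |MvPolynomial.eval (indVec A) (lowDegree (2 * m) φ)| ≤ ε := by
  have h := hφ ⟨indVec A, indVec_mem_cubeLE.2 hA2⟩
  rwa [extendZero_apply_of_lt f hA, ← eval_lowDegree φ (2 * m) A hA2, zero_sub, abs_neg] at h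

lemma abs_eval_le_three_halves (hφ : Approximates φ (extendZero f (2 * m)) ε)
    (hf : ∀ x, f x ∈ Set.Icc (-1 : ℝ) 1) (hε : ε ∈ Set.Ioo (0 : ℝ) (1 / 2))
    {A : Finset (Fin N)} (hA : #A ≤ 2 * m) :
    |MvPolynomial.eval (indVec A) (lowDegree (2 * m) φ)| ≤ 3 / 2 := by
  rcases le_or_gt #A m with h | h
  · have h1 := abs_sub_eval_le hφ h
    have h2 := hf ⟨indVec A, indVec_mem_cubeLE.2 h⟩
    rw [abs_le] at h1 ⊢
    constructor <;> linarith [h1.1, h1.2, h2.1, h2.2, hε.2]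
  · linarith [abs_eval_le hφ h hA, hε.2]

lemma approximates_extendApproximant_of_le (hφ : Approximates φ (extendZero f (2 * m)) ε)
    (hδ : 0 < δ) (hn : n ≤ 2 * m) :
    Approximates (extendApproximant c n m δ φ) (extendZero f n) (ε + δ) := by
  rintro ⟨x, hx⟩
  obtain ⟨A, hA, rfl⟩ := exists_eq_indVec hx
  dsimp only
  rw [eval_extendApproximant, multiplier, if_pos hn, Polynomial.eval_one, mul_one]
  rcases le_or_gt #A m with h | h
  · rw [extendZero_apply_of_le f h]
    linarith [abs_sub_eval_le hφ h]
  · rw [extendZero_apply_of_lt f h, zero_sub, abs_neg]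
    linarith [abs_eval_le hφ h (by omega)]

lemma approximates_extendApproximant_zero {f : cubeLE N 0 → ℝ}
    (hφ : Approximates φ (extendZero f (2 * 0)) ε)
    (hf : ∀ x, f x ∈ Set.Icc (-1 : ℝ) 1) (hε : ε ∈ Set.Ioo (0 : ℝ) (1 / 2))
    (hδ : δ ∈ Set.Ioo (0 : ℝ) (1 / 2)) (hn : 0 < n) :
    Approximates (extendApproximant c n 0 δ φ) (extendZero f n) (ε + δ) := by
  rintro ⟨x, hx⟩
  obtain ⟨A, hA, rfl⟩ := exists_eq_indVec hx
  dsimp only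
  rw [eval_extendApproximant]
  rcases Nat.eq_zero_or_pos #A with h | h
  · rw [extendZero_apply_of_le f h.le, show (#A : ℝ) = 0 by exact_mod_cast h,
      eval_zero_multiplier_zero hn, mul_one]
    linarith [abs_sub_eval_le hφ h.le, hδ.1]
  · rw [extendZero_apply_of_lt f h, zero_sub, abs_neg, abs_mul]
    have hM := abs_eval_multiplier_zero_le (c := c)
      (e := (lowDegree (2 * 0) φ).totalDegree) (t := #A) (n := n) hδ.1
      (by exact_mod_cast h) (by exact_mod_cast hA)
    -- The reduced approximant is a constant of absolute value at most 1 + ε, and (1+ε)δ ≤ ε + δ.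
    have hdeg : (lowDegree (2 * 0) φ).totalDegree = 0 :=
      Nat.le_zero.1 (totalDegree_lowDegree_le φ (2 * 0)).1
    have hconst := MvPolynomial.totalDegree_eq_zero_iff_eq_C.1 hdeg
    have h0 := abs_sub_eval_le hφ (A := ∅) (by simp)
    have hf0 := hf ⟨indVec ∅, indVec_mem_cubeLE.2 (by simp)⟩
    rw [hconst, MvPolynomial.eval_C] at h0 ⊢
    rw [← hconst]
    have hb : |MvPolynomial.coeff 0 (lowDegree (2 * 0) φ)| ≤ 1 + ε := by
      rw [abs_le] at h0 ⊢
      constructor <;> linarith [h0.1, h0.2, hf0.1, hf0.2]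
    calc _ ≤ (1 + ε) * δ := mul_le_mul hb hM (abs_nonneg _) (by linarith [hε.1])
      _ ≤ _ := by nlinarith [hε.1, hδ.2]

/-- Three ranges of weight: up to m, where M is within α of 1; from m to 2m, where 0 ≤ M ≤ 1
preserves the error ε; and beyond 2m, where the decay of M beats the growth of the approximant. -/
lemma approximates_extendApproximant_pos (hc : Admissible c)
    (hφ : Approximates φ (extendZero f (2 * m)) ε)
    (hf : ∀ x, f x ∈ Set.Icc (-1 : ℝ) 1) (hε : ε ∈ Set.Ioo (0 : ℝ) (1 / 2))
    (hδ : δ ∈ Set.Ioo (0 : ℝ) (1 / 2)) (hm : 0 < m) (hn : 2 * m < n) :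
    Approximates (extendApproximant c n m δ φ) (extendZero f n) (ε + δ) := by
  rintro ⟨x, hx⟩
  obtain ⟨A, hA, rfl⟩ := exists_eq_indVec hx
  dsimp only
  rw [eval_extendApproximant, eval_multiplier_pos hm hn]
  obtain ⟨hdm, -⟩ := totalDegree_lowDegree_le φ (2 * m)
  have h32 := fun (S : Finset (Fin N)) (hS : #S ≤ 2 * m) =>
    abs_eval_le_three_halves hφ hf hε hS
  set d := max (lowDegree (2 * m) φ).totalDegree 1 with hd
  have hd1 : 1 ≤ d := le_max_right _ _
  have hd2 : d ≤ 2 * m := max_le hdm (by omega)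
  obtain ⟨hα0, hα1⟩ := decay_pos_le hδ.1 hδ.2 d
  set α := δ / (4 * Real.exp 1) ^ (d + 1) with hα
  have hαle : α ≤ 1 := by linarith [hδ.2]
  have hm' : (0 : ℝ) < m := by exact_mod_cast hm
  have hs : 2 ≤ (n : ℝ) / m := by
    rw [le_div_iff₀ hm']
    exact_mod_cast hn.le
  have ht0 : 0 ≤ (#A : ℝ) / m := by positivity
  rcases le_or_gt #A m with h | h
  · have ht1 : (#A : ℝ) / m ≤ 1 := (div_le_one hm').2 (by exact_mod_cast h)
    have hM1 := one_sub_le_eval_intervalPoly hc hd1 hα0 hαle hs ht0 ht1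
    have hM2 := (eval_intervalPoly_mem_Icc (c := c) hd1 hα0 hαle hs ht0 (by linarith)).2
    rw [extendZero_apply_of_le f h]
    have h1 := abs_sub_eval_le hφ h
    have h2 := h32 A (by omega)
    set M := (intervalPoly c (n / m) d α).eval (#A / m : ℝ)
    set p := MvPolynomial.eval (indVec A) (lowDegree (2 * m) φ)
    set v := f ⟨indVec A, indVec_mem_cubeLE.2 h⟩
    calc |v - p * M| = |(v - p) + p * (1 - M)| := by ring_nf
      _ ≤ |v - p| + |p| * |1 - M| := by
          rw [← abs_mul]; exact abs_add_le _ _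
      _ ≤ ε + 3 / 2 * α := by
          gcongr
          rw [abs_of_nonneg (by linarith)]
          linarith
      _ ≤ ε + δ := by linarith [hδ.1]
  rcases le_or_gt #A (2 * m) with h' | h'
  · have ht2 : (#A : ℝ) / m ≤ 2 := (div_le_iff₀ hm').2 (by exact_mod_cast h')
    obtain ⟨hM1, hM2⟩ := eval_intervalPoly_mem_Icc (c := c) hd1 hα0 hαle hs ht0 ht2
    rw [extendZero_apply_of_lt f h, zero_sub, abs_neg, abs_mul, abs_of_nonneg hM1]
    have h1 := abs_eval_le hφ h h'
    calc _ ≤ ε * 1 := mul_le_mul h1 hM2 hM1 hε.1.le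
      _ ≤ _ := by linarith [hδ.1]
  · have ht2 : 2 ≤ (#A : ℝ) / m := (le_div_iff₀ hm').2 (by exact_mod_cast h'.le)
    have hts : (#A : ℝ) / m ≤ n / m := by
      gcongr
    obtain ⟨hM1, hM2⟩ := pow_mul_eval_intervalPoly_le hc hd1 hα0 hαle hs ht2 hts
    rw [extendZero_apply_of_lt f h, zero_sub, abs_neg, abs_mul, abs_of_nonneg hM1]
    have h1 := abs_eval_indVec_le hd1 hd2 (le_max_left _ _) h32 h'.le
    set M := (intervalPoly c (n / m) d α).eval (#A / m : ℝ)
    have he := Real.add_one_le_exp (1 : ℝ)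
    calc _ ≤ 3 / 2 * (2 * Real.exp 1 * (#A / m)) ^ d * M := by gcongr
      _ = 3 / 2 * (2 * Real.exp 1) ^ d * ((#A / m : ℝ) ^ d * M) := by rw [mul_pow]; ring
      -- The denominator (4e)^(d+1) of α is meant to cancel exactly this factor.
      _ ≤ (4 * Real.exp 1) * (4 * Real.exp 1) ^ d * α := by
          gcongr
          · linarith
          · norm_num
      _ = δ := by
          rw [hα, ← pow_succ']
          field_simp
      _ ≤ _ := by linarith [hε.1]

lemma approximates_extendApproximant (hc : Admissible c)
    (hφ : Approximates φ (extendZero f (2 * m)) ε)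
    (hf : ∀ x, f x ∈ Set.Icc (-1 : ℝ) 1) (hε : ε ∈ Set.Ioo (0 : ℝ) (1 / 2))
    (hδ : δ ∈ Set.Ioo (0 : ℝ) (1 / 2)) :
    Approximates (extendApproximant c n m δ φ) (extendZero f n) (ε + δ) := by
  rcases le_or_gt n (2 * m) with hn | hn
  · exact approximates_extendApproximant_of_le hφ hδ.1 hn
  rcases Nat.eq_zero_or_pos m with rfl | hm
  · exact approximates_extendApproximant_zero hφ hf hε hδ (by omega)
  · exact approximates_extendApproximant_pos hc hφ hf hε hδ hm hn

end approximation

lemma totalDegree_extendApproximant_le_mul {c n m : ℕ} {δ : ℝ} (hc : 1 ≤ c) (hmn : m ≤ n)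
    (hδ : δ ∈ Set.Ioo (0 : ℝ) (1 / 2)) (φ : MvPolynomial (Fin N) ℝ) :
    ((extendApproximant c n m δ φ).totalDegree : ℝ) ≤
      140 * c ^ 2 * √((n : ℝ) / ((m : ℝ) + 1)) * (φ.totalDegree + Real.logb 2 (1 / δ)) := by
  have hL := one_lt_logb hδ.1 hδ.2
  have hc' : (1 : ℝ) ≤ c ^ 2 := one_le_pow₀ (by exact_mod_cast hc)
  obtain ⟨he1, he2⟩ := totalDegree_lowDegree_le φ (2 * m)
  refine le_trans (Nat.cast_le.2 (totalDegree_extendApproximant_le c n m δ φ)) ?_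
  set e := (lowDegree (2 * m) φ).totalDegree
  have he2' : (e : ℝ) ≤ φ.totalDegree := by exact_mod_cast he2
  set t : ℝ := (φ.totalDegree : ℝ)
  have ht : 0 ≤ t := le_trans (Nat.cast_nonneg e) he2'
  rcases le_or_gt n (2 * m) with hn | hn
  · have h1 : multiplier c n m δ e = 1 := by rw [multiplier, if_pos hn]
    rw [h1, Polynomial.natDegree_one, add_zero]
    rcases Nat.eq_zero_or_pos m with rfl | hm
    -- Here n = m = 0 and the right-hand side is 0, so the reduction to degree at most 2m = 0 is
    -- essential.
    · have : e = 0 := by omega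
      rw [this, Nat.cast_zero]
      positivity
    · have hs : 1 / 2 ≤ √((n : ℝ) / ((m : ℝ) + 1)) := by
        apply Real.le_sqrt_of_sq_le
        have hm' : (1 : ℝ) ≤ m := by exact_mod_cast hm
        have hn' : (m : ℝ) ≤ n := by exact_mod_cast hmn
        rw [le_div_iff₀ (by linarith)]
        linarith
      calc (e : ℝ) ≤ 140 * 1 * (1 / 2) * (t + Real.logb 2 (1 / δ)) := by linarith
        _ ≤ _ := by gcongr
  rcases Nat.eq_zero_or_pos m with rfl | hm
  · have : e = 0 := by omega
    rw [this, zero_add]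
    refine le_trans (Nat.cast_le.2 (natDegree_multiplier_zero_le (by omega))) ?_
    have hn1 : (1 : ℝ) ≤ n := by exact_mod_cast (show 1 ≤ n by omega)
    have hs1 : 1 ≤ √(n : ℝ) := Real.one_le_sqrt.2 hn1
    have h1 := (Nat.ceil_lt_add_one (Real.sqrt_nonneg (n : ℝ))).le
    have h2 := (Nat.ceil_lt_add_one (by linarith : 0 ≤ Real.logb 2 (1 / δ))).le
    push_cast
    rw [zero_add, div_one]
    calc (⌈Real.logb 2 (1 / δ)⌉₊ : ℝ) * ⌈√(n : ℝ)⌉₊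
        ≤ (2 * Real.logb 2 (1 / δ)) * (2 * √(n : ℝ)) := by
          gcongr <;> linarith
      _ = 4 * 1 * √(n : ℝ) * (0 + Real.logb 2 (1 / δ)) := by ring
      _ ≤ _ := by gcongr; norm_num
  · exact natDegree_multiplier_add_le hc hm hn hδ.1 hδ.2 (by linarith)

/-! ### Passage to the approximate degree -/

lemma approxDeg_le {k : ℕ} {F : cubeLE N k → ℝ} {ε : ℝ} {p : MvPolynomial (Fin N) ℝ}
    (hp : Approximates p F ε) : approxDeg ε F ≤ p.totalDegree :=
  Nat.sInf_le ⟨p, le_rfl, hp⟩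

/-- Interpolation makes the set of admissible degrees nonempty, so that `sInf` is attained and is
not the default value 0. -/
lemma exists_totalDegree_le_approxDeg {k : ℕ} (F : cubeLE N k → ℝ) {ε : ℝ} (hε : 0 ≤ ε) :
    ∃ p : MvPolynomial (Fin N) ℝ, p.totalDegree ≤ approxDeg ε F ∧ Approximates p F ε := by
  obtain ⟨p, hp⟩ := exists_approximates F hε
  exact Nat.sInf_mem (s := {d : ℕ | ∃ p : MvPolynomial (Fin N) ℝ,
    p.totalDegree ≤ d ∧ Approximates p F ε}) ⟨p.totalDegree, p, le_rfl, hp⟩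

end ExtensionThm

theorem mainTheorem5 :
    ∃ (C : ℝ) (c : ℕ), 1 < C ∧
      ∀ (N m : ℕ), m ≤ N →
      ∀ (f : ExtensionThm.cubeLE N m → ℝ), (∀ x, f x ∈ Set.Icc (-1 : ℝ) 1) →
      ∀ (ε δ : ℝ), ε ∈ Set.Ioo (0 : ℝ) (1 / 2) → δ ∈ Set.Ioo (0 : ℝ) (1 / 2) →
      ∀ (n : ℕ), m ≤ n →
        ((ExtensionThm.approxDeg (ε + δ) (ExtensionThm.extendZero f n) : ℕ) : ℝ) ≤
            C * √((n : ℝ) / ((m : ℝ) + 1)) *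
              ((ExtensionThm.approxDeg ε (ExtensionThm.extendZero f (2 * m)) : ℕ) +
                Real.logb 2 (1 / δ)) ∧
        ∀ φ : MvPolynomial (Fin N) ℝ,
          ExtensionThm.Approximates φ (ExtensionThm.extendZero f (2 * m)) ε →
            ExtensionThm.Approximates (ExtensionThm.extendApproximant c n m δ φ)
                (ExtensionThm.extendZero f n) (ε + δ) ∧
              ((ExtensionThm.extendApproximant c n m δ φ).totalDegree : ℝ) ≤
                C * √((n : ℝ) / ((m : ℝ) + 1)) *
                  ((φ.totalDegree : ℝ) + Real.logb 2 (1 / δ)) := by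
  obtain ⟨c, hc⟩ := ExtensionThm.exists_admissible
  have hc1 : (1 : ℝ) ≤ (c : ℝ) ^ 2 := one_le_pow₀ (by exact_mod_cast hc.one_le)
  refine ⟨140 * (c : ℝ) ^ 2, c, by linarith, fun N m _ f hf ε δ hε hδ n hmn => ⟨?_, fun φ hφ =>
    ⟨ExtensionThm.approximates_extendApproximant hc hφ hf hε hδ,
      ExtensionThm.totalDegree_extendApproximant_le_mul hc.one_le hmn hδ φ⟩⟩⟩
  obtain ⟨φ, hdeg, hφ⟩ := ExtensionThm.exists_totalDegree_le_approxDeg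
    (ExtensionThm.extendZero f (2 * m)) hε.1.le
  refine le_trans (Nat.cast_le.2 (ExtensionThm.approxDeg_le
    (ExtensionThm.approximates_extendApproximant (n := n) hc hφ hf hε hδ))) ?_
  refine (ExtensionThm.totalDegree_extendApproximant_le_mul hc.one_le hmn hδ φ).trans ?_
  gcongr
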